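/- Let $\mu$ be a probability distribution on the subsets of $[m]=\{1,\dots,m\}$ that is strongly Rayleigh, i.e. its generating polynomial $g_\mu(z)=\sum_{T\subseteq[m]}\mu(T)\prod_{e\in T}z_e$ is real stable: $g_\mu(z)\neq 0$ for every $z\in\mathbb{C}^m$ with $\operatorname{Im}(z_e)>0$ for all $e\in[m]$. Let $B_1,\dots,B_n\subseteq[m]$ be pairwise disjoint, and for a random set $T\sim\mu$ let $A_i=|T\cap B_i|$. Fix $\kappa\in\mathbb{Z}_{\geq 0}^n$, and for $S\subseteq[n]$ put $A_S=\sum_{i\in S}A_i$ and $\kappa_S=\sum_{i\in S}\kappa_i$. Suppose that $|\mathbb{E}_\mu[A_S]-\kappa_S|<1$ for all $S\subseteq[n]$. For $1\leq k\leq n$ define $$\delta_k := 1+\min_{S\subseteq[n],\,|S|=k}\left(\mathbb{E}_\mu[A_S]-\kappa_S\right),\qquad \epsilon_k := 1-\max_{S\subseteq[n],\,|S|=k}\left(\mathbb{E}_\mu[A_S]-\kappa_S\right).$$ Then $\delta_k>0$ and $\epsilon_k>0$ for all $1\leq k\leq n$, and $$\mathbb{P}_\mu\left[A_1=\kappa_1,\dots,A_n=\kappa_n\right]\;\geq\;\prod_{i=1}^n\frac{\kappa_i^{\kappa_i}e^{-\kappa_i}}{\kappa_i!}\cdot\min_{0\leq\ell\leq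 n}\left(\prod_{k=1}^{\ell}\epsilon_k\prod_{k=1}^{n-\ell}\delta_k\right),$$ with the convention $0^0=1$. -/

import Mathlib

/-- The generating polynomial `g_μ(z) = ∑_{T ⊆ [m]} μ(T) ∏_{e ∈ T} z_e` of a probability
distribution `μ` on the subsets of `[m]`. -/
noncomputable def generatingPolynomial {m : ℕ} (μ : PMF (Finset (Fin m))) :
    MvPolynomial (Fin m) ℝ :=
  ∑ T : Finset (Fin m), MvPolynomial.C (μ T).toReal * ∏ e ∈ T, MvPolynomial.X e

/-- A real polynomial is real stable if it does not vanish when all its inputs are in the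
open complex upper half-plane. -/
def IsRealStable {m : ℕ} (p : MvPolynomial (Fin m) ℝ) : Prop :=
  ∀ z : Fin m → ℂ, (∀ i, 0 < (z i).im) → MvPolynomial.aeval z p ≠ 0

/-- A probability distribution on the subsets of `[m]` is strongly Rayleigh if its generating
polynomial is real stable. -/
def IsStronglyRayleigh {m : ℕ} (μ : PMF (Finset (Fin m))) : Prop :=
  IsRealStable (generatingPolynomial μ)

/-- The probability, under `μ`, of the event `p`. -/
noncomputable def prob {m : ℕ} (μ : PMF (Finset (Fin m))) (p : Finset (Fin m) → Prop)
    [DecidablePred p] : ℝ :=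
  ∑ T : Finset (Fin m) with p T, (μ T).toReal

/-- The expectation, under `μ`, of the real random variable `X`. -/
noncomputable def expect {m : ℕ} (μ : PMF (Finset (Fin m))) (X : Finset (Fin m) → ℝ) : ℝ :=
  ∑ T : Finset (Fin m), (μ T).toReal * X T

/-- The random variable `A_i`, counting the elements of the random set `T` that lie in `B i`. -/
def count {m n : ℕ} (B : Fin n → Finset (Fin m)) (i : Fin n) (T : Finset (Fin m)) : ℕ :=
  (T ∩ B i).card

/-- The deviation `E_μ[A_S] - κ_S`, where `A_S = ∑_{i ∈ S} A_i` and `κ_S = ∑_{i ∈ S} κ_i`. -/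
noncomputable def deviation {m n : ℕ} (μ : PMF (Finset (Fin m))) (B : Fin n → Finset (Fin m))
    (κ : Fin n → ℕ) (S : Finset (Fin n)) : ℝ :=
  expect μ (fun T => ∑ i ∈ S, (count B i T : ℝ)) - ∑ i ∈ S, (κ i : ℝ)

/-- `δ_k = 1 + min_{|S| = k} (E_μ[A_S] - κ_S)`. It is used only for `1 ≤ k ≤ n`, where the
infimum is over a finite nonempty family and hence is a minimum. -/
noncomputable def deltaCoeff {m n : ℕ} (μ : PMF (Finset (Fin m))) (B : Fin n → Finset (Fin m))
    (κ : Fin n → ℕ) (k : ℕ) : ℝ :=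
  1 + ⨅ S : {S : Finset (Fin n) // S.card = k}, deviation μ B κ S

/-- `ε_k = 1 - max_{|S| = k} (E_μ[A_S] - κ_S)`. It is used only for `1 ≤ k ≤ n`, where the
supremum is over a finite nonempty family and hence is a maximum. -/
noncomputable def epsilonCoeff {m n : ℕ} (μ : PMF (Finset (Fin m))) (B : Fin n → Finset (Fin m))
    (κ : Fin n → ℕ) (k : ℕ) : ℝ :=
  1 - ⨆ S : {S : Finset (Fin n) // S.card = k}, deviation μ B κ S

/-! Let F(x) = E ∏ x_i ^ A_i, a polynomial whose coefficient at x^κ is the wanted probability. The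
proof bounds that coefficient in two stages.

Capacity (`exists_capacity_bound`): F(x) ≥ A ∏ x_i ^ κ_i for all positive x, where A is the minimum
in the theorem. By real-rootedness each A_S is distributed as a sum of independent Bernoulli
variables, and this stays true after tilting by a positive external field. So a lower bound κ_S - 1
+ δ on its mean makes its generating function at least δ t ^ κ_S for t ≥ 1; the dual statement with
ε holds for t ≤ 1. If all x_i ≥ 1 on a family S of blocks, raise the field on the whole union by the
smallest x_i, pay one factor δ_{|S|}, drop that block and continue with the ratios. This works
because a field on a union does not lower the means of its sub-unions, which follows from the growth
estimate `massWith_mul_massWithout_le`, a consequence of the Schwarz lemma. Blocks with x_i < 1 are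
treated dually with ε, after the others; negative correlation (`average_tilt_le_of_disjoint`)
preserves their upper bounds. The index ℓ counts the blocks with x_i < 1.

Coefficient (`prod_poissonMode_mul_le_coefficient`): variables are removed one at a time. In one
variable the polynomial is real-rooted, the sequence k! q_k is log-concave, and comparison with an
exponential series costs exactly the Poisson factor `poissonMode`.

The capacity argument only yields coefficients capped at 1; `exists_prod_mul_prod_le_truncated`
removes the cap. -/

/-! ### Harnack inequality and stability in several variables -/

open Polynomial in
/-- A Harnack-type inequality for polynomials without zeros in the upper half-plane. -/
theorem norm_eval_le_of_no_zeros {q : ℂ[X]} (hq : ∀ t : ℂ, 0 < t.im → q.eval t ≠ 0)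
    {z : ℂ} (hz : 0 < z.im) (c : ℂ) {d : ℕ} (hd : q.natDegree ≤ d) :
    ‖q.eval c‖ ≤ (1 + ‖c - z‖ / z.im) ^ d * ‖q.eval z‖ := by
  have hsplit := IsAlgClosed.splits q
  -- Compare root by root: Im r ≤ 0 gives |z - r| ≥ Im z, so |c - r| ≤ |c - z| + |z - r| is a
  -- bounded multiple of |z - r|. The constant depends on the roots only through their number.
  have key : ∀ s : Multiset ℂ, (∀ r ∈ s, r.im ≤ 0) →
      ‖(s.map fun r => c - r).prod‖ ≤
        (1 + ‖c - z‖ / z.im) ^ Multiset.card s * ‖(s.map fun r => z - r).prod‖ := by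
    intro s
    induction s using Multiset.induction with
    | empty => simp
    | cons r s ih =>
      intro h
      have hr : r.im ≤ 0 := h r (by simp)
      have ih := ih fun x hx => h x (by simp [hx])
      simp only [Multiset.map_cons, Multiset.prod_cons, norm_mul, Multiset.card_cons, pow_succ]
      have h1 : z.im ≤ ‖z - r‖ := by
        have := Complex.abs_im_le_norm (z - r)
        have h2 := le_abs_self (z - r).im
        simp only [Complex.sub_im] at *
        linarith
      have h3 : ‖c - r‖ ≤ (1 + ‖c - z‖ / z.im) * ‖z - r‖ := by
        have e : c - r = (c - z) + (z - r) := by ring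
        have h4 : ‖c - z‖ ≤ ‖c - z‖ / z.im * ‖z - r‖ := by
          rw [div_mul_eq_mul_div, le_div_iff₀ hz]
          exact mul_le_mul_of_nonneg_left h1 (norm_nonneg _)
        calc ‖c - r‖ ≤ ‖c - z‖ + ‖z - r‖ := by rw [e]; exact norm_add_le _ _
          _ ≤ _ := by linarith
      calc _ ≤ ((1 + ‖c - z‖ / z.im) * ‖z - r‖) * ((1 + ‖c - z‖ / z.im) ^ Multiset.card s *
            ‖(s.map fun r => z - r).prod‖) := by gcongr
        _ = _ := by ring
  have hq0 : q ≠ 0 := by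
    rintro rfl
    exact hq Complex.I (by simp) (by simp)
  have hroots : ∀ r ∈ q.roots, r.im ≤ 0 := by
    intro r hr
    by_contra h
    exact hq r (not_le.1 h) ((mem_roots hq0).1 hr)
  rw [hsplit.eval_eq_prod_roots, hsplit.eval_eq_prod_roots, norm_mul, norm_mul]
  have h1 : (1 : ℝ) ≤ 1 + ‖c - z‖ / z.im := by
    have : 0 ≤ ‖c - z‖ / z.im := by positivity
    linarith
  have h2 := (key q.roots hroots).trans (mul_le_mul_of_nonneg_right
    (pow_le_pow_right₀ h1 ((card_roots' q).trans hd)) (norm_nonneg _))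
  calc _ ≤ _ := mul_le_mul_of_nonneg_left h2 (norm_nonneg _)
    _ = _ := by ring

/-- The value at `z` of the polynomial `∑ T, c T * ∏ i ∈ R, z i ^ a T i`. -/
noncomputable def monoSum {ι σ : Type*} [Fintype ι] (c : ι → ℂ) (a : ι → σ → ℕ) (R : Finset σ)
    (z : σ → ℂ) : ℂ :=
  ∑ T, c T * ∏ i ∈ R, z i ^ a T i

/-- Nonvanishing of `monoSum c a R` when all variables lie in the upper half-plane. -/
def StableOn {ι σ : Type*} [Fintype ι] (c : ι → ℂ) (a : ι → σ → ℕ) (R : Finset σ) : Prop :=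
  ∀ z : σ → ℂ, (∀ i, 0 < (z i).im) → monoSum c a R z ≠ 0

/-! ### A Hurwitz theorem for stable polynomials with fixed exponents -/

section Hurwitz

variable {ι σ : Type*} [Fintype ι] [DecidableEq σ]

open Polynomial in
/-- The polynomial obtained from `monoSum` by fixing all variables but one. -/
theorem exists_polynomial_monoSum_update (c : ι → ℂ) (a : ι → σ → ℕ) (R : Finset σ)
    {i : σ} (hi : i ∈ R) (z : σ → ℂ) (t : ℂ) :
    monoSum c a R (Function.update z i t) =
      (∑ T, C (c T * ∏ j ∈ R.erase i, z j ^ a T j) * X ^ a T i : ℂ[X]).eval t := by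
  rw [monoSum, eval_finsetSum]
  refine Finset.sum_congr rfl fun T _ => ?_
  rw [← Finset.mul_prod_erase R _ hi]
  simp only [Function.update_self, eval_mul, eval_C, eval_pow, eval_X]
  have : ∏ j ∈ R.erase i, Function.update z i t j ^ a T j = ∏ j ∈ R.erase i, z j ^ a T j :=
    Finset.prod_congr rfl fun j hj => by rw [Function.update_of_ne (Finset.ne_of_mem_erase hj)]
  rw [this]
  ring

-- The point is that `K` is independent of the coefficients `c`, so the estimate survives passage to
-- a limit of polynomials.
open Polynomial in
theorem norm_monoSum_update_le (a : ι → σ → ℕ) (R : Finset σ) (i : σ) (z : σ → ℂ)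
    (hz : ∀ i, 0 < (z i).im) (t : ℂ) :
    ∃ K : ℝ, 0 ≤ K ∧ ∀ c : ι → ℂ, StableOn c a R →
      ‖monoSum c a R (Function.update z i t)‖ ≤ K * ‖monoSum c a R z‖ := by
  by_cases hi : i ∈ R
  · refine ⟨(1 + ‖t - z i‖ / (z i).im) ^ (∑ T, a T i), ?_, fun c hc => ?_⟩
    · have := hz i
      positivity
    · have h := norm_eval_le_of_no_zeros
        (q := ∑ T, C (c T * ∏ j ∈ R.erase i, z j ^ a T j) * X ^ a T i) (d := ∑ T, a T i)
        (fun s hs => by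
          rw [← exists_polynomial_monoSum_update c a R hi]
          refine hc _ fun j => ?_
          by_cases hj : j = i
          · subst hj; simpa using hs
          · simpa [hj] using hz j) (hz i) t ?_
      · rw [← exists_polynomial_monoSum_update c a R hi,
          ← exists_polynomial_monoSum_update c a R hi, Function.update_eq_self] at h
        exact h
      · refine natDegree_sum_le_of_forall_le _ _ fun T _ => ?_
        exact (natDegree_C_mul_X_pow_le _ _).trans
          (Finset.single_le_sum (f := fun T => a T i) (fun _ _ => Nat.zero_le _)
            (Finset.mem_univ T))
  · refine ⟨1, zero_le_one, fun c _ => ?_⟩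
    rw [one_mul]
    apply le_of_eq
    congr 1
    refine Finset.sum_congr rfl fun T _ => ?_
    congr 1
    refine Finset.prod_congr rfl fun j hj => ?_
    rw [Function.update_of_ne]
    rintro rfl
    exact hi hj

/-- Move from `z` to `v` one coordinate at a time, staying in the upper half-plane; the Harnack
constants multiply. -/
theorem norm_monoSum_le (a : ι → σ → ℕ) (R : Finset σ) (z v : σ → ℂ)
    (hz : ∀ i, 0 < (z i).im) (hv : ∀ i, 0 < (v i).im) :
    ∃ K : ℝ, 0 ≤ K ∧ ∀ c : ι → ℂ, StableOn c a R →
      ‖monoSum c a R v‖ ≤ K * ‖monoSum c a R z‖ := by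
  have key : ∀ S : Finset σ, ∃ K : ℝ, 0 ≤ K ∧ ∀ c : ι → ℂ, StableOn c a R →
      ‖monoSum c a R (S.piecewise v z)‖ ≤ K * ‖monoSum c a R z‖ := by
    intro S
    induction S using Finset.induction with
    | empty => exact ⟨1, zero_le_one, fun c _ => by simp⟩
    | insert i S hi ih =>
      obtain ⟨K, hK, h⟩ := ih
      obtain ⟨K', hK', h'⟩ := norm_monoSum_update_le a R i (S.piecewise v z) (fun j => by
        by_cases hj : j ∈ S <;> simp [hj, hz, hv]) (v i)
      refine ⟨K' * K, by positivity, fun c hc => ?_⟩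
      rw [Finset.piecewise_insert, mul_assoc]
      exact (h' c hc).trans (mul_le_mul_of_nonneg_left (h c hc) hK')
  obtain ⟨K, hK, h⟩ := key R
  refine ⟨K, hK, fun c hc => ?_⟩
  have := h c hc
  have e : monoSum c a R (R.piecewise v z) = monoSum c a R v := by
    refine Finset.sum_congr rfl fun T _ => ?_
    congr 1
    exact Finset.prod_congr rfl fun j hj => by simp [hj]
  rwa [e] at this

open Filter Topology in
/-- A limit of stable polynomials is stable, unless its value at the all-ones point vanishes. -/
theorem StableOn.of_tendsto {α : Type*} {l : Filter α} [l.NeBot] {a : ι → σ → ℕ} {R : Finset σ}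
    {c : α → ι → ℂ} {c₀ : ι → ℂ} (hlim : ∀ T, Tendsto (fun k => c k T) l (𝓝 (c₀ T)))
    (hc : ∀ᶠ k in l, StableOn (c k) a R) (h0 : ∑ T, c₀ T ≠ 0) : StableOn c₀ a R := by
  intro z hz hzero
  have hconv : ∀ v, Tendsto (fun k => monoSum (c k) a R v) l (𝓝 (monoSum c₀ a R v)) := fun v =>
    tendsto_finsetSum _ fun T _ => (hlim T).mul_const _
  -- The Harnack bound passes to the limit, so a single zero forces vanishing on the whole product
  -- of half-planes.
  have hv : ∀ v : σ → ℂ, (∀ i, 0 < (v i).im) → monoSum c₀ a R v = 0 := by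
    intro v hv
    obtain ⟨K, hK, h⟩ := norm_monoSum_le a R z v hz hv
    have := le_of_tendsto_of_tendsto (hconv v).norm ((hconv z).norm.const_mul K)
      (hc.mono fun k hk => h (c k) hk)
    rw [hzero] at this
    simpa using this
  -- The all-ones point lies on the boundary of the domain and is approached along 1 + ηi; there the
  -- vanishing contradicts `h0`.
  have hcont : Tendsto (fun η : ℝ => monoSum c₀ a R fun _ => 1 + η * Complex.I) (𝓝[>] 0)
      (𝓝 (∑ T, c₀ T)) := by
    have : Continuous fun η : ℝ => monoSum c₀ a R fun _ => 1 + η * Complex.I := by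
      unfold monoSum
      fun_prop
    have h := (this.tendsto 0).mono_left (nhdsWithin_le_nhds (s := Set.Ioi 0))
    simpa [monoSum] using h
  have hz' : Tendsto (fun η : ℝ => monoSum c₀ a R fun _ => 1 + η * Complex.I) (𝓝[>] 0)
      (𝓝 0) := by
    refine tendsto_const_nhds.congr' ?_
    filter_upwards [self_mem_nhdsWithin] with η hη
    exact (hv _ fun _ => by simpa using hη).symm
  exact h0 (tendsto_nhds_unique hcont hz')

end Hurwitz

/-! ### Closure of stability under specialization and coefficient extraction -/

section Closure

variable {ι σ : Type*} [Fintype ι] [DecidableEq σ]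

open Filter Topology in
/-- Setting some of the variables of a stable polynomial to `1` preserves stability. -/
theorem StableOn.mono {c : ι → ℂ} {a : ι → σ → ℕ} {R R' : Finset σ} (hc : StableOn c a R)
    (hR : R' ⊆ R) (h0 : ∑ T, c T ≠ 0) : StableOn c a R' := by
  -- The variables to be removed are set to 1 + ηi, and η decreases to 0.
  refine StableOn.of_tendsto (l := 𝓝[>] (0 : ℝ))
    (c := fun η T => c T * ∏ i ∈ R \ R', (1 + (η : ℂ) * Complex.I) ^ a T i) (fun T => ?_) ?_ h0
  · have : Continuous fun η : ℝ => c T * ∏ i ∈ R \ R', (1 + (η : ℂ) * Complex.I) ^ a T i := by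
      fun_prop
    have h := (this.tendsto 0).mono_left (nhdsWithin_le_nhds (s := Set.Ioi 0))
    simpa using h
  · filter_upwards [self_mem_nhdsWithin] with η hη z hz
    have h := hc (R'.piecewise z fun _ => 1 + (η : ℂ) * Complex.I) fun i => by
      by_cases hi : i ∈ R'
      · simpa [hi] using hz i
      · simpa [hi] using hη
    convert h using 1
    refine Finset.sum_congr rfl fun T _ => ?_
    rw [← Finset.prod_sdiff hR, mul_assoc]
    congr 2
    · exact Finset.prod_congr rfl fun i hi => by simp [(Finset.mem_sdiff.1 hi).2]
    · exact Finset.prod_congr rfl fun i hi => by simp [hi]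

section Coefficient

open Polynomial Filter Topology

/-- The operator `q ↦ δ q + q'` on complex polynomials. -/
noncomputable def shiftedDerivative (δ : ℝ) : ℂ[X] →ₗ[ℂ] ℂ[X] :=
  (δ : ℂ) • LinearMap.id + derivative

/-- Gauss–Lucas: q'/q = ∑ 1/(t - r) has negative imaginary part, or is zero if there are no roots.
Adding δ > 0 avoids zero in both cases, whereas the bare derivative may vanish identically. -/
theorem shiftedDerivative_eval_ne_zero {δ : ℝ} (hδ : 0 < δ) {q : ℂ[X]}
    (hq : ∀ t : ℂ, 0 < t.im → q.eval t ≠ 0) (t : ℂ) (ht : 0 < t.im) :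
    (shiftedDerivative δ q).eval t ≠ 0 := by
  have hne := hq t ht
  have hq0 : q ≠ 0 := by
    rintro rfl
    simp at hne
  have hdiv := (IsAlgClosed.splits q).eval_derivative_eq_eval_mul_sum hne
  have hroots : ∀ r ∈ q.roots, r.im ≤ 0 := by
    intro r hr
    by_contra h
    exact hq r (not_le.1 h) ((mem_roots hq0).1 hr)
  have key : ∀ s : Multiset ℂ, (∀ r ∈ s, r.im ≤ 0) →
      (s.map fun r => 1 / (t - r)).sum = 0 ∨ (s.map fun r => 1 / (t - r)).sum.im < 0 := by
    intro s
    induction s using Multiset.induction with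
    | empty => simp
    | cons r s ih =>
      intro h
      have hr : r.im ≤ 0 := h r (by simp)
      right
      have h1 : (1 / (t - r)).im < 0 := by
        have h2 : 0 < (t - r).im := by simp; linarith
        have h3 : t - r ≠ 0 := by
          intro h4
          rw [h4] at h2
          simp at h2
        rw [one_div, Complex.inv_im]
        exact div_neg_of_neg_of_pos (by linarith) (Complex.normSq_pos.2 h3)
      rw [Multiset.map_cons, Multiset.sum_cons, Complex.add_im]
      rcases ih fun x hx => h x (by simp [hx]) with h2 | h2
      · rw [h2]; simpa using h1
      · linarith
  simp only [shiftedDerivative, LinearMap.add_apply, LinearMap.smul_apply, LinearMap.id_apply,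
    eval_add, eval_smul, smul_eq_mul]
  rw [hdiv]
  have : (δ : ℂ) + (q.roots.map fun z => 1 / (t - z)).sum ≠ 0 := by
    rcases key q.roots hroots with h | h
    · rw [h]; simpa using hδ.ne'
    · intro h2
      have := congrArg Complex.im h2
      simp at this
      simp at h
      linarith
  intro h
  apply mul_ne_zero hne this
  linear_combination h

theorem iterate_shiftedDerivative_eval_ne_zero {δ : ℝ} (hδ : 0 < δ) (k : ℕ) {q : ℂ[X]}
    (hq : ∀ t : ℂ, 0 < t.im → q.eval t ≠ 0) (t : ℂ) (ht : 0 < t.im) :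
    ((shiftedDerivative δ ^ k) q).eval t ≠ 0 := by
  induction k generalizing q with
  | zero => simpa using hq t ht
  | succ k ih =>
    rw [pow_succ, Module.End.mul_apply]
    exact ih (shiftedDerivative_eval_ne_zero hδ hq)

theorem continuous_iterate_shiftedDerivative_eval (k : ℕ) (q : ℂ[X]) :
    Continuous fun δ : ℝ => ((shiftedDerivative δ ^ k) q).eval ((δ : ℂ) * Complex.I) := by
  induction k generalizing q with
  | zero =>
    simp only [pow_zero, Module.End.one_apply]
    fun_prop
  | succ k ih =>
    have : (fun δ : ℝ => ((shiftedDerivative δ ^ (k + 1)) q).eval ((δ : ℂ) * Complex.I)) =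
        fun δ : ℝ => (δ : ℂ) * ((shiftedDerivative δ ^ k) q).eval ((δ : ℂ) * Complex.I) +
          ((shiftedDerivative δ ^ k) (derivative q)).eval ((δ : ℂ) * Complex.I) := by
      funext δ
      rw [pow_succ, Module.End.mul_apply]
      conv_lhs => rw [shiftedDerivative]
      simp only [LinearMap.add_apply, LinearMap.smul_apply, LinearMap.id_apply, map_add, map_smul,
        eval_add, eval_smul, smul_eq_mul]
      rfl
    rw [this]
    have := ih q
    have := ih (derivative q)
    fun_prop

theorem iterate_shiftedDerivative_zero_eval (k n : ℕ) :
    ((shiftedDerivative 0 ^ k) (X ^ n : ℂ[X])).eval 0 = if n = k then (k.factorial : ℂ) else 0 := by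
  have : shiftedDerivative 0 = derivative := by
    simp [shiftedDerivative]
  rw [this, Module.End.pow_apply, ← coeff_zero_eq_eval_zero, coeff_iterate_derivative, coeff_X_pow]
  by_cases h : n = k
  · simp [h, Nat.descFactorial_self]
  · simp [h, Ne.symm h]

/-- Extracting the coefficient of a power of one variable of a stable polynomial yields a stable
polynomial, unless it vanishes at the all-ones point. -/
theorem StableOn.coefficient {c : ι → ℂ} {a : ι → σ → ℕ} {R : Finset σ} (hc : StableOn c a R)
    {i : σ} (hi : i ∈ R) (k : ℕ) (h0 : ∑ T, (if a T i = k then c T else 0) ≠ 0) :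
    StableOn (fun T => if a T i = k then c T else 0) a (R.erase i) := by
  have hfac : (k.factorial : ℂ) ≠ 0 := by exact_mod_cast k.factorial_ne_zero
  -- The coefficient of t^k is the limit of (δ + d/dt)^k / k! evaluated at t = δi as δ decreases to
  -- 0. One parameter regularizes the derivative and keeps the evaluation point in the upper
  -- half-plane.
  refine StableOn.of_tendsto (l := 𝓝[>] (0 : ℝ))
    (c := fun δ T => c T * ((shiftedDerivative δ ^ k) (X ^ a T i : ℂ[X])).eval
      ((δ : ℂ) * Complex.I) / k.factorial) (fun T => ?_) ?_ h0
  · have h := (((continuous_iterate_shiftedDerivative_eval k (X ^ a T i)).tendsto 0).mono_left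
      (nhdsWithin_le_nhds (s := Set.Ioi 0))).const_mul (c T) |>.div_const (k.factorial : ℂ)
    convert h using 2
    simp only [Complex.ofReal_zero, zero_mul, iterate_shiftedDerivative_zero_eval]
    by_cases h : a T i = k
    · simp [h, hfac]
    · simp [h]
  · filter_upwards [self_mem_nhdsWithin] with δ hδ z hz
    have h := iterate_shiftedDerivative_eval_ne_zero (Set.mem_Ioi.1 hδ) k
      (q := ∑ T, C (c T * ∏ j ∈ R.erase i, z j ^ a T j) * X ^ a T i) (fun s hs => by
        rw [← exists_polynomial_monoSum_update c a R hi]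
        refine hc _ fun j => ?_
        by_cases hj : j = i
        · subst hj; simpa using hs
        · simpa [hj] using hz j) ((δ : ℂ) * Complex.I) (by simpa using hδ)
    have e : monoSum (fun T => c T * ((shiftedDerivative δ ^ k) (X ^ a T i : ℂ[X])).eval
        ((δ : ℂ) * Complex.I) / k.factorial) a (R.erase i) z =
        ((shiftedDerivative δ ^ k) (∑ T, C (c T * ∏ j ∈ R.erase i, z j ^ a T j) *
          X ^ a T i)).eval ((δ : ℂ) * Complex.I) / k.factorial := by
      rw [map_sum, eval_finsetSum, Finset.sum_div, monoSum]
      refine Finset.sum_congr rfl fun T _ => ?_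
      rw [← smul_eq_C_mul, map_smul, eval_smul, smul_eq_mul]
      ring
    rw [e]
    exact div_ne_zero h hfac

end Coefficient

end Closure

/-! ### Schwarz lemma on the slit plane -/

/-- A holomorphic self-map `h` of the slit plane that is positive at `1` and at a real `t ≥ 1`
satisfies `h t ≤ t * h 1`: this is the Schwarz lemma for `w ↦ √(h (w ^ 2))` on the right
half-plane. -/
theorem le_mul_of_mapsTo_slitPlane {h : ℂ → ℂ} (hd : DifferentiableOn ℂ h Complex.slitPlane)
    (hm : ∀ z ∈ Complex.slitPlane, h z ∈ Complex.slitPlane) {A B t : ℝ} (hA : 0 < A)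
    (h1 : h 1 = A) (hB : 0 < B) (ht : 1 ≤ t) (hht : h t = B) : B ≤ t * A := by
  have hre : ∀ z ∈ Complex.slitPlane, 0 < (Complex.exp (Complex.log z / 2)).re := by
    intro z hz
    rw [Complex.exp_re]
    refine mul_pos (Real.exp_pos _) (Real.cos_pos_of_mem_Ioo ?_)
    have h1 := Complex.neg_pi_lt_arg z
    have h2 := lt_of_le_of_ne (Complex.arg_le_pi z) (Complex.mem_slitPlane_iff_arg.1 hz).1
    have : (Complex.log z / 2).im = Complex.arg z / 2 := by
      rw [show (2 : ℂ) = ((2 : ℝ) : ℂ) by norm_num, Complex.div_ofReal_im, Complex.log_im]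
    rw [this]
    constructor <;> linarith
  have hsq : ∀ w : ℂ, 0 < w.re → w ^ 2 ∈ Complex.slitPlane := by
    intro w hw
    rw [Complex.mem_slitPlane_iff]
    by_cases hi : w.im = 0
    · left
      simp [pow_two, hi]
      positivity
    · right
      intro h0
      simp only [pow_two, Complex.mul_im] at h0
      rcases mul_eq_zero.1 (show w.re * w.im = 0 by linarith) with h2 | h2
      · exact hw.ne' h2
      · exact hi h2
  have hcay : ∀ k : ℂ, 0 < k.re → ‖(k - 1) / (k + 1)‖ < 1 := by
    intro k hk
    have hne : k + 1 ≠ 0 := by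
      intro h
      have := congrArg Complex.re h
      simp at this
      linarith
    rw [norm_div, div_lt_one (norm_pos_iff.2 hne)]
    apply lt_of_pow_lt_pow_left₀ 2 (norm_nonneg _)
    rw [← Complex.normSq_eq_norm_sq, ← Complex.normSq_eq_norm_sq, Complex.normSq_apply,
      Complex.normSq_apply]
    simp
    nlinarith
  have hcay' : ∀ ζ : ℂ, ‖ζ‖ < 1 → 0 < ((1 + ζ) / (1 - ζ)).re := by
    intro ζ hζ
    have hne : 1 - ζ ≠ 0 := by
      intro h
      have : ζ = 1 := by linear_combination -h
      simp [this] at hζ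
    rw [Complex.div_re, ← add_div]
    apply div_pos _ (Complex.normSq_pos.2 hne)
    have h2 : Complex.normSq ζ < 1 := by
      rw [Complex.normSq_eq_norm_sq]
      have := norm_nonneg ζ
      nlinarith
    rw [Complex.normSq_apply] at h2
    simp
    nlinarith
  -- `k` is the square root of h(w²)/A, a self-map of the right half-plane fixing 1.
  set k : ℂ → ℂ := fun w => Complex.exp (Complex.log (h (w ^ 2) / A) / 2) with hk
  have hdivA : ∀ w : ℂ, 0 < w.re → h (w ^ 2) / A ∈ Complex.slitPlane := by
    intro w hw
    have h2 := hm _ (hsq w hw)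
    rw [Complex.mem_slitPlane_iff] at h2 ⊢
    rw [Complex.div_ofReal_re, Complex.div_ofReal_im]
    rcases h2 with h2 | h2
    · left; positivity
    · right; exact div_ne_zero h2 hA.ne'
  -- Conjugating `k` by the Cayley transform gives a self-map of the disc fixing 0, to which the
  -- Schwarz lemma applies.
  set Φ : ℂ → ℂ := fun ζ => (k ((1 + ζ) / (1 - ζ)) - 1) / (k ((1 + ζ) / (1 - ζ)) + 1) with hΦ
  have hkre : ∀ ζ ∈ Metric.ball (0 : ℂ) 1, 0 < (k ((1 + ζ) / (1 - ζ))).re := fun ζ hζ =>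
    hre _ (hdivA _ (hcay' ζ (by simpa using hζ)))
  have hΦd : DifferentiableOn ℂ Φ (Metric.ball 0 1) := by
    have hw : DifferentiableOn ℂ (fun ζ : ℂ => (1 + ζ) / (1 - ζ)) (Metric.ball 0 1) := by
      refine DifferentiableOn.div (by fun_prop) (by fun_prop) fun ζ hζ h0 => ?_
      have : ζ = 1 := by linear_combination -h0
      simp [this] at hζ
    have hkd : DifferentiableOn ℂ (fun ζ => k ((1 + ζ) / (1 - ζ))) (Metric.ball 0 1) := by
      refine DifferentiableOn.cexp (DifferentiableOn.div_const (DifferentiableOn.clog ?_ ?_) 2)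
      · refine DifferentiableOn.div_const ?_ _
        exact hd.comp (hw.pow 2) fun ζ hζ => hsq _ (hcay' ζ (by simpa using hζ))
      · exact fun ζ hζ => hdivA _ (hcay' ζ (by simpa using hζ))
    refine DifferentiableOn.div (hkd.sub_const 1) (hkd.add_const 1) fun ζ hζ h0 => ?_
    have h2 := hkre ζ hζ
    have := congrArg Complex.re h0
    simp only [Complex.add_re, Complex.one_re, Complex.zero_re] at this
    linarith
  have hΦm : Set.MapsTo Φ (Metric.ball 0 1) (Metric.closedBall 0 1) := by
    intro ζ hζ
    rw [mem_closedBall_zero_iff]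
    exact (hcay _ (hkre ζ hζ)).le
  have hA' : (A : ℂ) ≠ 0 := by exact_mod_cast hA.ne'
  have hΦ0 : Φ 0 = 0 := by
    simp [hΦ, hk, h1, hA']
  set s : ℝ := √t with hs
  have hs1 : 1 ≤ s := Real.one_le_sqrt.2 ht
  have hst : s ^ 2 = t := Real.sq_sqrt (by linarith)
  have hnorm : ‖(((s - 1) / (s + 1) : ℝ) : ℂ)‖ = (s - 1) / (s + 1) := by
    rw [Complex.norm_real, Real.norm_of_nonneg]
    apply div_nonneg <;> linarith
  have hlt : (s - 1) / (s + 1) < 1 := by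
    rw [div_lt_one (by linarith)]
    linarith
  have hmain := Complex.norm_le_norm_of_mapsTo_ball hΦd hΦm hΦ0
    (z := (((s - 1) / (s + 1) : ℝ) : ℂ)) (by rw [hnorm]; exact hlt)
  set u : ℝ := Real.exp (Real.log (B / A) / 2) with hu
  have husq : u ^ 2 = B / A := by
    rw [hu, ← Real.exp_nat_mul]
    push_cast
    rw [mul_div_cancel₀ _ (two_ne_zero), Real.exp_log (by positivity)]
  have hwt : (1 + (((s - 1) / (s + 1) : ℝ) : ℂ)) / (1 - (((s - 1) / (s + 1) : ℝ) : ℂ)) = s := by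
    have : (1 + (s - 1) / (s + 1)) / (1 - (s - 1) / (s + 1)) = s := by
      field_simp
      ring
    exact_mod_cast this
  have hkt : k s = u := by
    simp only [hk, hu]
    rw [show (s : ℂ) ^ 2 = t by exact_mod_cast hst, hht, ← Complex.ofReal_div,
      ← Complex.ofReal_log (by positivity)]
    push_cast
    rfl
  have hΦt : Φ (((s - 1) / (s + 1) : ℝ) : ℂ) = (((u - 1) / (u + 1) : ℝ) : ℂ) := by
    simp only [hΦ]
    rw [hwt, hkt]
    push_cast
    rfl
  have hu0 : 0 < u := Real.exp_pos _
  rw [hΦt, hnorm, Complex.norm_real, Real.norm_eq_abs] at hmain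
  have h3 := (le_abs_self _).trans hmain
  rw [div_le_div_iff₀ (by linarith) (by linarith)] at h3
  -- The Schwarz inequality at w = √t reads (u - 1)/(u + 1) ≤ (s - 1)/(s + 1), where u² = B/A and s²
  -- = t.
  have h4 : u ≤ s := by nlinarith
  have h5 : u ^ 2 ≤ s ^ 2 := by gcongr
  rw [husq, hst, div_le_iff₀ hA] at h5
  exact h5

/-! ### Stable weights: external fields, odds and negative correlation -/

section Weights

variable {m : ℕ}

/-- The exponent of the variable `e` in the monomial of the set `T`. -/
def indicatorExponent (T : Finset (Fin m)) (e : Fin m) : ℕ := if e ∈ T then 1 else 0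

/-- A nonnegative nonzero weight on subsets whose generating polynomial is stable. -/
structure IsStableWeight (w : Finset (Fin m) → ℝ) : Prop where
  nonneg : ∀ T, 0 ≤ w T
  mass_pos : 0 < ∑ T, w T
  stable : StableOn (fun T => (w T : ℂ)) indicatorExponent Finset.univ

theorem prod_pow_indicatorExponent (T R : Finset (Fin m)) (z : Fin m → ℂ) :
    ∏ e ∈ R, z e ^ indicatorExponent T e = ∏ e ∈ T ∩ R, z e := by
  rw [Finset.inter_comm, ← Finset.filter_mem_eq_inter, Finset.prod_filter]
  refine Finset.prod_congr rfl fun e _ => ?_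
  by_cases h : e ∈ T <;> simp [indicatorExponent, h]

/-- The weight `w` multiplied by `∏ e ∈ T, y e`. -/
def tilt (w : Finset (Fin m) → ℝ) (y : Fin m → ℝ) (T : Finset (Fin m)) : ℝ :=
  w T * ∏ e ∈ T, y e

/-- The external field with value `t` on `Y` and `1` elsewhere. -/
def field (Y : Finset (Fin m)) (t : ℝ) (e : Fin m) : ℝ := if e ∈ Y then t else 1

theorem prod_field (T Y : Finset (Fin m)) (t : ℝ) : ∏ e ∈ T, field Y t e = t ^ (T ∩ Y).card := by
  unfold field
  rw [← Finset.prod_filter, Finset.prod_const, Finset.filter_mem_eq_inter]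

theorem tilt_field (w : Finset (Fin m) → ℝ) (Y T : Finset (Fin m)) (t : ℝ) :
    tilt w (field Y t) T = w T * t ^ (T ∩ Y).card := by
  rw [tilt, prod_field]

theorem tilt_tilt (w : Finset (Fin m) → ℝ) (y y' : Fin m → ℝ) :
    tilt (tilt w y) y' = tilt w (fun e => y e * y' e) := by
  funext T
  simp only [tilt, Finset.prod_mul_distrib, mul_assoc]

theorem IsStableWeight.tilt {w : Finset (Fin m) → ℝ} (hw : IsStableWeight w) {y : Fin m → ℝ}
    (hy : ∀ e, 0 < y e) : IsStableWeight (tilt w y) where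
  nonneg T := mul_nonneg (hw.nonneg T) (Finset.prod_nonneg fun e _ => (hy e).le)
  mass_pos := by
    obtain ⟨T, -, hT⟩ : ∃ T ∈ Finset.univ, 0 < w T := by
      by_contra! h
      exact absurd hw.mass_pos (not_lt.2 (Finset.sum_nonpos h))
    exact Finset.sum_pos' (fun T _ => mul_nonneg (hw.nonneg T)
      (Finset.prod_nonneg fun e _ => (hy e).le))
      ⟨T, Finset.mem_univ T, mul_pos hT (Finset.prod_pos fun e _ => hy e)⟩
  stable := by
    intro z hz
    have h := hw.stable (fun e => (y e : ℂ) * z e) fun e => by simpa using mul_pos (hy e) (hz e)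
    convert h using 1
    refine Finset.sum_congr rfl fun T _ => ?_
    simp only [prod_pow_indicatorExponent, Finset.inter_univ, _root_.tilt,
      Finset.prod_mul_distrib]
    push_cast
    ring

theorem IsStableWeight.tilt_field {w : Finset (Fin m) → ℝ} (hw : IsStableWeight w)
    (Y : Finset (Fin m)) {t : ℝ} (ht : 0 < t) : IsStableWeight (_root_.tilt w (field Y t)) :=
  hw.tilt fun e => by unfold field; split_ifs <;> linarith

theorem IsStableWeight.stableOn {w : Finset (Fin m) → ℝ} (hw : IsStableWeight w)
    (R : Finset (Fin m)) : StableOn (fun T => (w T : ℂ)) indicatorExponent R :=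
  hw.stable.mono (Finset.subset_univ R) (by exact_mod_cast hw.mass_pos.ne')

/-- The generating function of `|T ∩ Y|` over the sets containing `e`. -/
noncomputable def withElement (w : Finset (Fin m) → ℝ) (e : Fin m) (Y : Finset (Fin m)) (t : ℂ) :
    ℂ :=
  ∑ T, (if e ∈ T then (w T : ℂ) else 0) * t ^ (T ∩ Y).card

/-- The generating function of `|T ∩ Y|` over the sets not containing `e`. -/
noncomputable def withoutElement (w : Finset (Fin m) → ℝ) (e : Fin m) (Y : Finset (Fin m))
    (t : ℂ) : ℂ :=
  ∑ T, (if e ∈ T then 0 else (w T : ℂ)) * t ^ (T ∩ Y).card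

theorem differentiable_withElement (w : Finset (Fin m) → ℝ) (e : Fin m) (Y : Finset (Fin m)) :
    Differentiable ℂ (withElement w e Y) := by
  unfold withElement
  fun_prop

theorem differentiable_withoutElement (w : Finset (Fin m) → ℝ) (e : Fin m)
    (Y : Finset (Fin m)) : Differentiable ℂ (withoutElement w e Y) := by
  unfold withoutElement
  fun_prop

theorem withElement_conj (w : Finset (Fin m) → ℝ) (e : Fin m) (Y : Finset (Fin m)) (t : ℂ) :
    withElement w e Y (starRingEnd ℂ t) = starRingEnd ℂ (withElement w e Y t) := by
  simp only [withElement, map_sum, map_mul, map_pow]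
  refine Finset.sum_congr rfl fun T _ => ?_
  split_ifs <;> simp

theorem withoutElement_conj (w : Finset (Fin m) → ℝ) (e : Fin m) (Y : Finset (Fin m)) (t : ℂ) :
    withoutElement w e Y (starRingEnd ℂ t) = starRingEnd ℂ (withoutElement w e Y t) := by
  simp only [withoutElement, map_sum, map_mul, map_pow]
  refine Finset.sum_congr rfl fun T _ => ?_
  split_ifs <;> simp

/-- The weight of the sets containing `e`, with `|T ∩ Y|` marked by a real `t`. -/
def massWith (w : Finset (Fin m) → ℝ) (e : Fin m) (Y : Finset (Fin m)) (t : ℝ) : ℝ :=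
  ∑ T, (if e ∈ T then w T else 0) * t ^ (T ∩ Y).card

/-- The weight of the sets not containing `e`, with `|T ∩ Y|` marked by a real `t`. -/
def massWithout (w : Finset (Fin m) → ℝ) (e : Fin m) (Y : Finset (Fin m)) (t : ℝ) : ℝ :=
  ∑ T, (if e ∈ T then 0 else w T) * t ^ (T ∩ Y).card

theorem withElement_ofReal (w : Finset (Fin m) → ℝ) (e : Fin m) (Y : Finset (Fin m)) (t : ℝ) :
    withElement w e Y t = massWith w e Y t := by
  simp only [withElement, massWith]
  push_cast
  refine Finset.sum_congr rfl fun T _ => ?_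
  split_ifs <;> simp

theorem withoutElement_ofReal (w : Finset (Fin m) → ℝ) (e : Fin m) (Y : Finset (Fin m))
    (t : ℝ) : withoutElement w e Y t = massWithout w e Y t := by
  simp only [withoutElement, massWithout]
  push_cast
  refine Finset.sum_congr rfl fun T _ => ?_
  split_ifs <;> simp

section Fixed

variable {w : Finset (Fin m) → ℝ} (hw : IsStableWeight w) {e : Fin m} {Y : Finset (Fin m)}
  {t : ℝ}
include hw

theorem massWith_nonneg (ht : 0 ≤ t) : 0 ≤ massWith w e Y t :=
  Finset.sum_nonneg fun T _ => mul_nonneg (by split_ifs; exacts [hw.nonneg T, le_rfl]) (by positivity)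

theorem massWithout_nonneg (ht : 0 ≤ t) : 0 ≤ massWithout w e Y t :=
  Finset.sum_nonneg fun T _ => mul_nonneg (by split_ifs; exacts [le_rfl, hw.nonneg T]) (by positivity)

theorem eq_zero_of_massWith_one_eq_zero (h : massWith w e Y 1 = 0) (T : Finset (Fin m))
    (hT : e ∈ T) : w T = 0 := by
  rw [massWith, Finset.sum_eq_zero_iff_of_nonneg] at h
  · simpa [hT] using h T (Finset.mem_univ T)
  · intro T _
    exact mul_nonneg (by split_ifs; exacts [hw.nonneg T, le_rfl]) (by simp)

theorem massWith_pos (h : 0 < massWith w e Y 1) (ht : 0 < t) : 0 < massWith w e Y t := by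
  refine lt_of_le_of_ne (massWith_nonneg hw ht.le) fun h0 => h.ne' ?_
  rw [massWith, eq_comm, Finset.sum_eq_zero_iff_of_nonneg] at h0
  · refine Finset.sum_eq_zero fun T hT => ?_
    have := h0 T hT
    rcases mul_eq_zero.1 this with h1 | h1
    · rw [h1, zero_mul]
    · exact absurd h1 (by positivity)
  · intro T _
    exact mul_nonneg (by split_ifs; exacts [hw.nonneg T, le_rfl]) (by positivity)

/-- This is the coefficient of the variable of `e`, with the variables in `Y` identified and the
remaining ones set to 1. -/
theorem withElement_ne_zero (heY : e ∉ Y) (h : 0 < massWith w e Y 1) {s : ℂ} (hs : 0 < s.im) :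
    withElement w e Y s ≠ 0 := by
  have hsum : ∑ T, (if indicatorExponent T e = 1 then (w T : ℂ) else 0) ≠ 0 := by
    have h1 : ((massWith w e Y 1 : ℝ) : ℂ) ≠ 0 := by exact_mod_cast h.ne'
    convert h1 using 1
    rw [← withElement_ofReal, withElement]
    refine Finset.sum_congr rfl fun T _ => ?_
    by_cases hT : e ∈ T <;> simp [indicatorExponent, hT]
  have h2 := (hw.stable.coefficient (Finset.mem_univ e) 1 hsum).mono (R' := Y)
    (fun x hx => by
      rw [Finset.mem_erase]
      exact ⟨fun h => heY (h ▸ hx), Finset.mem_univ x⟩) hsum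
  have h3 := h2 (fun _ => s) fun _ => hs
  convert h3 using 1
  refine Finset.sum_congr rfl fun T _ => ?_
  rw [prod_pow_indicatorExponent, Finset.prod_const]
  by_cases hT : e ∈ T <;> simp [indicatorExponent, hT]

theorem mul_withElement_add_withoutElement_ne_zero (heY : e ∉ Y) {z s : ℂ} (hz : 0 < z.im)
    (hs : 0 < s.im) : z * withElement w e Y s + withoutElement w e Y s ≠ 0 := by
  have h := hw.stableOn (insert e Y) (fun x => if x = e then z else s) fun x => by
    split_ifs <;> assumption
  convert h using 1
  rw [withElement, withoutElement, Finset.mul_sum, ← Finset.sum_add_distrib]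
  refine Finset.sum_congr rfl fun T _ => ?_
  rw [Finset.prod_insert heY, prod_pow_indicatorExponent]
  have : ∏ x ∈ T ∩ Y, (if x = e then z else s) = s ^ (T ∩ Y).card := by
    rw [← Finset.prod_const]
    refine Finset.prod_congr rfl fun x hx => ?_
    rw [if_neg]
    rintro rfl
    exact heY (Finset.mem_inter.1 hx).2
  rw [this]
  by_cases hT : e ∈ T
  · simp [indicatorExponent, hT]; ring
  · simp [indicatorExponent, hT]

/-- The polynomial is affine in the variable of `e`; a ratio with negative imaginary part would
place its root in the upper half-plane. -/
theorem im_withoutElement_div_withElement_nonneg (heY : e ∉ Y) (h : 0 < massWith w e Y 1) {s : ℂ}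
    (hs : 0 < s.im) : 0 ≤ (withoutElement w e Y s / withElement w e Y s).im := by
  by_contra! hneg
  have hne := withElement_ne_zero hw heY h hs
  refine mul_withElement_add_withoutElement_ne_zero hw heY
    (z := -(withoutElement w e Y s / withElement w e Y s)) (by simpa using hneg) hs ?_
  field_simp
  ring

/-- The odds that `e` is absent grow at most linearly in an external field. -/
theorem massWith_mul_massWithout_le (heY : e ∉ Y) (ht : 1 ≤ t) :
    massWith w e Y 1 * massWithout w e Y t ≤ t * massWith w e Y t * massWithout w e Y 1 := by
  have ht0 : 0 < t := by linarith
  rcases (massWith_nonneg hw (e := e) (Y := Y) zero_le_one).eq_or_lt with h | h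
  · rw [← h, zero_mul]
    exact mul_nonneg (mul_nonneg ht0.le (massWith_nonneg hw ht0.le))
      (massWithout_nonneg hw zero_le_one)
  have htpos := massWith_pos hw h ht0
  have hne : ∀ z ∈ Complex.slitPlane, withElement w e Y z ≠ 0 := by
    intro z hz
    rcases lt_trichotomy z.im 0 with hi | hi | hi
    · have h1 := withElement_ne_zero hw heY h (s := starRingEnd ℂ z) (by simpa using hi)
      rw [withElement_conj] at h1
      intro h2
      simp [h2] at h1
    · have hz' : z = (z.re : ℂ) := Complex.ext (by simp) (by simpa using hi)
      rw [Complex.mem_slitPlane_iff] at hz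
      have hzr : 0 < z.re := by simpa [hi] using hz
      rw [hz', withElement_ofReal]
      exact_mod_cast (massWith_pos hw h hzr).ne'
    · exact withElement_ne_zero hw heY h hi
  -- Adding z to the ratio pushes it strictly into the slit plane and makes it positive on the
  -- positive axis. The conclusion is unaffected: the extra t on the left cancels t * 1 on the
  -- right.
  have hB := le_mul_of_mapsTo_slitPlane
    (h := fun z => withoutElement w e Y z / withElement w e Y z + z)
    (A := massWithout w e Y 1 / massWith w e Y 1 + 1)
    (B := massWithout w e Y t / massWith w e Y t + t) (t := t)
    (DifferentiableOn.add (DifferentiableOn.div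
      (differentiable_withoutElement w e Y).differentiableOn
      (differentiable_withElement w e Y).differentiableOn hne) differentiableOn_id)
    (fun z hz => by
      rw [Complex.mem_slitPlane_iff]
      rcases lt_trichotomy z.im 0 with hi | hi | hi
      · right
        have h1 := im_withoutElement_div_withElement_nonneg hw heY h (s := starRingEnd ℂ z)
          (by simpa using hi)
        rw [withElement_conj, withoutElement_conj, ← map_div₀, Complex.conj_im] at h1
        rw [Complex.add_im]
        linarith
      · left
        have hz' : z = (z.re : ℂ) := Complex.ext (by simp) (by simpa using hi)
        rw [Complex.mem_slitPlane_iff] at hz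
        have hzr : 0 < z.re := by simpa [hi] using hz
        rw [hz', withElement_ofReal, withoutElement_ofReal, ← Complex.ofReal_div,
          ← Complex.ofReal_add, Complex.ofReal_re]
        have := div_nonneg (massWithout_nonneg hw (e := e) (Y := Y) hzr.le)
          (massWith_pos hw h hzr).le
        linarith
      · right
        have h1 := im_withoutElement_div_withElement_nonneg hw heY h hi
        rw [Complex.add_im]
        linarith)
    (by
      have := div_nonneg (massWithout_nonneg hw (e := e) (Y := Y) zero_le_one) h.le
      linarith)
    (by
      have h1 := withElement_ofReal w e Y 1
      have h2 := withoutElement_ofReal w e Y 1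
      push_cast at h1 h2 ⊢
      rw [h1, h2])
    (by
      have := div_nonneg (massWithout_nonneg hw (e := e) (Y := Y) ht0.le) htpos.le
      linarith) ht
    (by
      rw [withElement_ofReal, withoutElement_ofReal]
      push_cast
      rfl)
  have h3 : massWithout w e Y t / massWith w e Y t ≤
      t * massWithout w e Y 1 / massWith w e Y 1 := by
    rw [mul_div_assoc]
    linarith
  rw [div_le_div_iff₀ htpos h] at h3
  linarith

/-- Pairwise negative correlation of stable weights. -/
theorem massWith_mul_massWithout_singleton_le {e' : Fin m} (he : e ≠ e') (ht : 1 ≤ t) :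
    massWith w e {e'} t * massWithout w e {e'} 1 ≤
      massWith w e {e'} 1 * massWithout w e {e'} t := by
  have ht0 : 0 < t := by linarith
  rcases (massWith_nonneg hw (e := e) (Y := {e'}) zero_le_one).eq_or_lt with h | h
  · have h0 : massWith w e {e'} t = 0 := by
      refine Finset.sum_eq_zero fun T _ => ?_
      by_cases hT : e ∈ T
      · rw [eq_zero_of_massWith_one_eq_zero hw h.symm T hT]; simp
      · simp [hT]
    rw [h0, ← h, zero_mul, zero_mul]
  have heY : e ∉ ({e'} : Finset (Fin m)) := by simpa using he
  -- With one element in `Y` both parts are affine, and the sign of the imaginary part at i is that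
  -- of g₁f₀ - g₀f₁, the negative correlation inequality.
  have him := im_withoutElement_div_withElement_nonneg hw heY h (s := Complex.I) (by simp)
  have hne := withElement_ne_zero hw heY h (s := Complex.I) (by simp)
  set f₀ := ∑ T, if e' ∈ T then 0 else if e ∈ T then w T else 0 with hf₀
  set f₁ := ∑ T, if e' ∈ T then (if e ∈ T then w T else 0) else 0 with hf₁
  set g₀ := ∑ T, if e' ∈ T then 0 else if e ∈ T then 0 else w T with hg₀
  set g₁ := ∑ T, if e' ∈ T then (if e ∈ T then 0 else w T) else 0 with hg₁
  have hF : ∀ s : ℂ, withElement w e {e'} s = f₀ + f₁ * s := by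
    intro s
    rw [hf₀, hf₁, withElement]
    push_cast
    rw [Finset.sum_mul, ← Finset.sum_add_distrib]
    refine Finset.sum_congr rfl fun T _ => ?_
    by_cases h1 : e' ∈ T <;> by_cases h2 : e ∈ T <;> simp [h1, h2]
  have hG : ∀ s : ℂ, withoutElement w e {e'} s = g₀ + g₁ * s := by
    intro s
    rw [hg₀, hg₁, withoutElement]
    push_cast
    rw [Finset.sum_mul, ← Finset.sum_add_distrib]
    refine Finset.sum_congr rfl fun T _ => ?_
    by_cases h1 : e' ∈ T <;> by_cases h2 : e ∈ T <;> simp [h1, h2]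
  have hF' : ∀ s : ℝ, massWith w e {e'} s = f₀ + f₁ * s := by
    intro s
    have := hF s
    rw [withElement_ofReal] at this
    exact_mod_cast this
  have hG' : ∀ s : ℝ, massWithout w e {e'} s = g₀ + g₁ * s := by
    intro s
    have := hG s
    rw [withoutElement_ofReal] at this
    exact_mod_cast this
  have hpos := Complex.normSq_pos.2 hne
  rw [Complex.div_im, ← sub_div, le_div_iff₀ hpos, zero_mul, hF, hG] at him
  simp at him
  rw [hF', hF', hG', hG']
  nlinarith [mul_nonneg (sub_nonneg.2 ht) (show 0 ≤ g₁ * f₀ - g₀ * f₁ by linarith)]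

end Fixed

end Weights

/-! ### Monotonicity of averages under external fields -/

section Averages

variable {m : ℕ}

/-- The average of `|T ∩ X|` for the weight `w`. -/
noncomputable def average (w : Finset (Fin m) → ℝ) (X : Finset (Fin m)) : ℝ :=
  (∑ T, w T * (T ∩ X).card) / ∑ T, w T

theorem sum_mul_card_inter (w : Finset (Fin m) → ℝ) (X : Finset (Fin m)) :
    ∑ T, w T * ((T ∩ X).card : ℝ) = ∑ e ∈ X, ∑ T, if e ∈ T then w T else 0 := by
  rw [Finset.sum_comm]
  refine Finset.sum_congr rfl fun T _ => ?_
  rw [← Finset.sum_filter, Finset.sum_const, Finset.filter_mem_eq_inter, Finset.inter_comm,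
    nsmul_eq_mul, mul_comm]

theorem sum_ite_add_sum_ite (w : Finset (Fin m) → ℝ) (e : Fin m) :
    ∑ T, w T = (∑ T, if e ∈ T then w T else 0) + ∑ T, if e ∈ T then 0 else w T := by
  rw [← Finset.sum_add_distrib]
  refine Finset.sum_congr rfl fun T _ => ?_
  split_ifs <;> simp

/-- An average is a sum of marginals, so it suffices to compare the odds of each element. After
cross-multiplication the term with `e` present in both weights cancels. -/
theorem average_le_average {w w' : Finset (Fin m) → ℝ} (hw : 0 < ∑ T, w T)
    (hw' : 0 < ∑ T, w' T) {X : Finset (Fin m)}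
    (h : ∀ e ∈ X, (∑ T, if e ∈ T then w T else 0) * (∑ T, if e ∈ T then 0 else w' T) ≤
      (∑ T, if e ∈ T then w' T else 0) * (∑ T, if e ∈ T then 0 else w T)) :
    average w X ≤ average w' X := by
  rw [average, average, div_le_div_iff₀ hw hw', sum_mul_card_inter, sum_mul_card_inter,
    Finset.sum_mul, Finset.sum_mul]
  refine Finset.sum_le_sum fun e he => ?_
  rw [sum_ite_add_sum_ite w e, sum_ite_add_sum_ite w' e]
  have := h e he
  linarith

variable {w : Finset (Fin m) → ℝ}

/-- An external field at least `1` on `Y` increases averages over subsets of `Y`. -/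
theorem average_le_average_tilt (hw : IsStableWeight w) {X Y : Finset (Fin m)} (hXY : X ⊆ Y)
    {t : ℝ} (ht : 1 ≤ t) : average w X ≤ average (tilt w (field Y t)) X := by
  refine average_le_average hw.mass_pos (hw.tilt_field Y (by linarith)).mass_pos fun e he => ?_
  have heY := hXY he
  -- Apply the field on `Y` without `e`: the odds against `e` grow by at most t, which is exactly
  -- offset by the factor t that the field gives to `e` itself.
  have h := massWith_mul_massWithout_le hw (Finset.notMem_erase e Y) ht
  have h1 : massWith w e (Y.erase e) 1 = ∑ T, if e ∈ T then w T else 0 := by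
    simp [massWith]
  have h2 : massWithout w e (Y.erase e) 1 = ∑ T, if e ∈ T then 0 else w T := by
    simp [massWithout]
  have h3 : t * massWith w e (Y.erase e) t =
      ∑ T, if e ∈ T then tilt w (field Y t) T else 0 := by
    rw [massWith, Finset.mul_sum]
    refine Finset.sum_congr rfl fun T _ => ?_
    split_ifs with hT
    · rw [tilt_field, Finset.inter_erase,
        ← Finset.card_erase_add_one (Finset.mem_inter.2 ⟨hT, heY⟩)]
      ring
    · simp
  have h4 : massWithout w e (Y.erase e) t =
      ∑ T, if e ∈ T then 0 else tilt w (field Y t) T := by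
    refine Finset.sum_congr rfl fun T _ => ?_
    split_ifs with hT
    · simp
    · rw [tilt_field, Finset.inter_erase, Finset.erase_eq_of_notMem]
      simp [hT]
  rwa [h1, h2, h3, h4] at h

/-- The inverse field is at least 1 and takes the tilted weight back to `w`. -/
theorem average_tilt_le_average (hw : IsStableWeight w) {X Y : Finset (Fin m)} (hXY : X ⊆ Y)
    {t : ℝ} (ht0 : 0 < t) (ht : t ≤ 1) : average (tilt w (field Y t)) X ≤ average w X := by
  have h := average_le_average_tilt (hw.tilt_field Y ht0) hXY ((one_le_inv₀ ht0).2 ht)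
  have e : tilt (tilt w (field Y t)) (field Y t⁻¹) = w := by
    funext T
    rw [tilt_field, tilt_field, mul_assoc, ← mul_pow, mul_inv_cancel₀ ht0.ne', one_pow, mul_one]
  rwa [e] at h

theorem average_tilt_singleton_le (hw : IsStableWeight w) {X : Finset (Fin m)} {e' : Fin m}
    (he' : e' ∉ X) {t : ℝ} (ht : 1 ≤ t) :
    average (tilt w (field {e'} t)) X ≤ average w X := by
  refine average_le_average (hw.tilt_field _ (by linarith)).mass_pos hw.mass_pos fun e he => ?_
  have h := massWith_mul_massWithout_singleton_le hw (e := e) (e' := e')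
    (fun h => he' (h ▸ he)) ht
  convert h using 2
  · refine Finset.sum_congr rfl fun T _ => ?_
    split_ifs
    · rw [tilt_field]
    · simp
  · simp [massWithout]
  · simp [massWith]
  · refine Finset.sum_congr rfl fun T _ => ?_
    split_ifs
    · simp
    · rw [tilt_field]

/-- An external field at least `1` outside of `X` decreases the average over `X`. -/
theorem average_tilt_le_of_disjoint (hw : IsStableWeight w) {X : Finset (Fin m)} {y : Fin m → ℝ}
    (hy : ∀ e, 1 ≤ y e) (hyX : ∀ e ∈ X, y e = 1) : average (tilt w y) X ≤ average w X := by
  -- Raise the field one element at a time: elements of `X` have field 1, and pairwise negative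
  -- correlation handles the others.
  have key : ∀ S : Finset (Fin m),
      IsStableWeight (tilt w (S.piecewise y 1)) ∧
        average (tilt w (S.piecewise y 1)) X ≤ average w X := by
    intro S
    induction S using Finset.induction with
    | empty =>
      have : tilt w ((∅ : Finset (Fin m)).piecewise y 1) = w := by
        funext T
        simp [tilt]
      rw [this]
      exact ⟨hw, le_rfl⟩
    | insert i S hi ih =>
      have e : tilt w ((insert i S).piecewise y 1) =
          tilt (tilt w (S.piecewise y 1)) (field {i} (y i)) := by
        rw [tilt_tilt]
        congr 1
        funext x
        by_cases hx : x = i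
        · subst hx
          simp [field, hi]
        · simp [field, Finset.piecewise, hx]
      rw [e]
      refine ⟨ih.1.tilt_field _ (by linarith [hy i]), ?_⟩
      by_cases hiX : i ∈ X
      · rw [hyX i hiX]
        have : tilt (tilt w (S.piecewise y 1)) (field {i} 1) = tilt w (S.piecewise y 1) := by
          funext T
          rw [tilt_field, one_pow, mul_one]
        rw [this]
        exact ih.2
      · exact (average_tilt_singleton_le ih.1 hiX (hy i)).trans ih.2
  have h := (key Finset.univ).2
  rwa [Finset.piecewise_univ] at h

end Averages

/-! ### Generating functions of sums of Bernoulli variables -/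

section Bernoulli

/-- For a fixed sum, spreading two probabilities apart decreases the product, so the minimum occurs
with `k` ones and one fractional value θ. The induction spreads (p, θ - p) to (θ, 0), or (p, 1 + θ -
p) to (1, θ). -/
theorem prod_one_add_mul_ge (l : Multiset ℝ) (hl : ∀ p ∈ l, 0 ≤ p ∧ p ≤ 1) {s : ℝ} (hs : 0 ≤ s)
    (k : ℕ) {θ : ℝ} (hθ : 0 ≤ θ) (hθ1 : θ ≤ 1) (hsum : l.sum = k + θ) :
    (1 + s) ^ k * (1 + θ * s) ≤ (l.map fun p => 1 + p * s).prod := by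
  induction l using Multiset.induction generalizing k θ with
  | empty =>
    simp only [Multiset.sum_zero] at hsum
    have hk : (k : ℝ) = 0 := by
      have : (0 : ℝ) ≤ k := k.cast_nonneg
      linarith
    have : θ = 0 := by linarith
    have hk' : k = 0 := by exact_mod_cast hk
    simp [this, hk']
  | cons p l ih =>
    obtain ⟨hp0, hp1⟩ := hl p (by simp)
    have hl' : ∀ p ∈ l, 0 ≤ p ∧ p ≤ 1 := fun q hq => hl q (by simp [hq])
    rw [Multiset.sum_cons] at hsum
    rw [Multiset.map_cons, Multiset.prod_cons]
    have hps : 0 ≤ 1 + p * s := by positivity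
    by_cases hpθ : p ≤ θ
    · have h := ih hl' k (θ := θ - p) (by linarith) (by linarith) (by linarith)
      calc (1 + s) ^ k * (1 + θ * s)
          ≤ (1 + p * s) * ((1 + s) ^ k * (1 + (θ - p) * s)) := by
            have h1 : 1 + θ * s ≤ (1 + p * s) * (1 + (θ - p) * s) := by
              have : 0 ≤ p * (θ - p) * s ^ 2 :=
                mul_nonneg (mul_nonneg hp0 (by linarith)) (by positivity)
              nlinarith
            have h2 : 0 ≤ (1 + s) ^ k := by positivity
            nlinarith
        _ ≤ _ := mul_le_mul_of_nonneg_left h hps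
    · have hpθ := not_le.1 hpθ
      have hsum0 : 0 ≤ l.sum := Multiset.sum_nonneg fun q hq => (hl' q hq).1
      obtain ⟨j, rfl⟩ : ∃ j, k = j + 1 := by
        refine ⟨k - 1, ?_⟩
        have : k ≠ 0 := by
          rintro rfl
          push_cast at hsum
          linarith
        omega
      push_cast at hsum
      have h := ih hl' j (θ := 1 + θ - p) (by linarith) (by linarith) (by linarith)
      calc (1 + s) ^ (j + 1) * (1 + θ * s)
          ≤ (1 + p * s) * ((1 + s) ^ j * (1 + (1 + θ - p) * s)) := by
            have h1 : (1 + s) * (1 + θ * s) ≤ (1 + p * s) * (1 + (1 + θ - p) * s) := by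
              have : 0 ≤ (p - θ) * (1 - p) * s ^ 2 :=
                mul_nonneg (mul_nonneg (by linarith) (by linarith)) (by positivity)
              nlinarith
            have h2 : 0 ≤ (1 + s) ^ j := by positivity
            rw [pow_succ]
            nlinarith
        _ ≤ _ := mul_le_mul_of_nonneg_left h hps

/-- If the success probabilities have sum at least `κ - 1 + δ`, then the generating function at
`t ≥ 1` is at least `δ * t ^ κ`. -/
theorem mul_pow_le_prod (l : Multiset ℝ) (hl : ∀ p ∈ l, 0 ≤ p ∧ p ≤ 1) {t : ℝ} (ht : 1 ≤ t)
    (κ : ℕ) {δ : ℝ} (hδ1 : δ ≤ 1) (hsum : (κ : ℝ) - 1 + δ ≤ l.sum) :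
    δ * t ^ κ ≤ (l.map fun p => 1 - p + p * t).prod := by
  have hsum0 : 0 ≤ l.sum := Multiset.sum_nonneg fun q hq => (hl q hq).1
  have h := prod_one_add_mul_ge l hl (sub_nonneg.2 ht) ⌊l.sum⌋₊ (θ := l.sum - ⌊l.sum⌋₊)
    (sub_nonneg.2 (Nat.floor_le hsum0)) (by linarith [Nat.lt_floor_add_one l.sum]) (by ring)
  have e : (l.map fun p => 1 + p * (t - 1)) = l.map fun p => 1 - p + p * t :=
    Multiset.map_congr rfl fun p _ => by ring
  rw [e, show 1 + (t - 1) = t by ring] at h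
  refine le_trans ?_ h
  have hf0 := Nat.floor_le hsum0
  have hf1 := Nat.lt_floor_add_one l.sum
  have htk : 0 < t ^ κ := by positivity
  by_cases hk : κ ≤ ⌊l.sum⌋₊
  · calc δ * t ^ κ ≤ 1 * t ^ κ := by gcongr
      _ ≤ t ^ ⌊l.sum⌋₊ := by rw [one_mul]; exact pow_le_pow_right₀ ht hk
      _ ≤ _ := le_mul_of_one_le_right (by positivity)
        (by nlinarith [mul_nonneg (sub_nonneg.2 hf0) (sub_nonneg.2 ht)])
  · by_cases hδ : δ ≤ 0
    · have h1 : 0 ≤ t ^ ⌊l.sum⌋₊ * (1 + (l.sum - ⌊l.sum⌋₊) * (t - 1)) :=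
        mul_nonneg (by positivity)
          (by nlinarith [mul_nonneg (sub_nonneg.2 hf0) (sub_nonneg.2 ht)])
      exact (mul_nonpos_of_nonpos_of_nonneg hδ htk.le).trans h1
    -- As δ > 0, the hypothesis allows κ to exceed the integer part of the sum by 1 at most; then δ
    -- is at most the fractional part.
    · have hk' : κ = ⌊l.sum⌋₊ + 1 := by
        have : (κ : ℝ) < (⌊l.sum⌋₊ : ℝ) + 2 := by linarith
        have : κ < ⌊l.sum⌋₊ + 2 := by exact_mod_cast this
        omega
      have h2 : δ ≤ l.sum - ⌊l.sum⌋₊ := by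
        rw [hk'] at hsum
        push_cast at hsum
        linarith
      rw [hk', pow_succ]
      have h3 : δ * t ≤ 1 + (l.sum - ⌊l.sum⌋₊) * (t - 1) := by nlinarith
      have h4 : 0 ≤ t ^ ⌊l.sum⌋₊ := by positivity
      nlinarith

/-- Exchange success and failure: p becomes 1 - p, t becomes 1/t, and κ becomes the number of
variables minus κ. If κ exceeds that number, t ^ κ is already small enough. -/
theorem mul_pow_le_prod_of_le_one (l : Multiset ℝ) (hl : ∀ p ∈ l, 0 ≤ p ∧ p ≤ 1) {t : ℝ}
    (ht0 : 0 < t) (ht : t ≤ 1) (κ : ℕ) {ε : ℝ} (hε1 : ε ≤ 1)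
    (hsum : l.sum ≤ κ + 1 - ε) :
    ε * t ^ κ ≤ (l.map fun p => 1 - p + p * t).prod := by
  have hmap : (l.map fun p => 1 - p + p * t).prod =
      t ^ Multiset.card l * ((l.map fun p => 1 - p).map fun p => 1 - p + p * t⁻¹).prod := by
    clear hsum hl
    induction l using Multiset.induction with
    | empty => simp
    | cons p l ih =>
      simp only [Multiset.map_cons, Multiset.prod_cons, Multiset.card_cons, ih]
      field_simp
      ring
  have hsum' : (l.map fun p => 1 - p).sum = Multiset.card l - l.sum := by
    clear hsum hl hmap
    induction l using Multiset.induction with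
    | empty => simp
    | cons p l ih =>
      simp only [Multiset.map_cons, Multiset.sum_cons, Multiset.card_cons, ih]
      push_cast
      ring
  rcases le_or_gt κ (Multiset.card l) with hk | hk
  · have h := mul_pow_le_prod (l.map fun p => 1 - p) (fun p hp => by
      obtain ⟨q, hq, rfl⟩ := Multiset.mem_map.1 hp
      have := hl q hq
      constructor <;> linarith) ((one_le_inv₀ ht0).2 ht) (Multiset.card l - κ) hε1 (by
        rw [hsum']
        push_cast [hk]
        linarith)
    rw [hmap]
    calc ε * t ^ κ = t ^ Multiset.card l * (ε * t⁻¹ ^ (Multiset.card l - κ)) := by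
          rw [← pow_sub_mul_pow t hk, inv_pow]
          field_simp
      _ ≤ _ := mul_le_mul_of_nonneg_left h (by positivity)
  · have h1 : t ^ κ ≤ t ^ Multiset.card l := pow_le_pow_of_le_one ht0.le ht hk.le
    have h2 : t ^ Multiset.card l ≤ (l.map fun p => 1 - p + p * t).prod := by
      rw [hmap]
      refine le_mul_of_one_le_right (by positivity) ?_
      have h := mul_pow_le_prod (l.map fun p => 1 - p) (fun p hp => by
        obtain ⟨q, hq, rfl⟩ := Multiset.mem_map.1 hp
        have := hl q hq
        constructor <;> linarith) ((one_le_inv₀ ht0).2 ht) 0 (δ := 1) le_rfl (by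
          have : 0 ≤ (l.map fun p => 1 - p).sum := Multiset.sum_nonneg fun x hx => by
            obtain ⟨q, hq, rfl⟩ := Multiset.mem_map.1 hx
            linarith [(hl q hq).2]
          simpa using this)
      simpa using h
    have : 0 < t ^ κ := by positivity
    nlinarith

end Bernoulli

/-! ### Real-rooted polynomials as Bernoulli sums -/

section Factorization

open Polynomial

/-- A real-rooted polynomial with nonnegative coefficients is, up to a factor, the generating
function of a sum of independent Bernoulli variables. -/
theorem exists_bernoulli_factorization {ι : Type*} [Fintype ι] {c : ι → ℝ} (hc : ∀ T, 0 ≤ c T)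
    (hpos : 0 < ∑ T, c T) (a : ι → ℕ)
    (hst : ∀ s : ℂ, 0 < s.im → ∑ T, (c T : ℂ) * s ^ a T ≠ 0) :
    ∃ l : Multiset ℝ, (∀ p ∈ l, 0 ≤ p ∧ p ≤ 1) ∧
      (∑ T, C (c T) * X ^ a T : ℝ[X]) =
        C (∑ T, c T) * (l.map fun p => C (1 - p) + C p * X).prod ∧
      ∑ T, c T * a T = (∑ T, c T) * l.sum := by
  set P : ℝ[X] := ∑ T, C (c T) * X ^ a T with hP
  have heval : ∀ t : ℝ, P.eval t = ∑ T, c T * t ^ a T := by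
    intro t
    simp [hP, eval_finsetSum]
  have hevalC : ∀ s : ℂ, (P.map (algebraMap ℝ ℂ)).eval s = ∑ T, (c T : ℂ) * s ^ a T := by
    intro s
    simp [hP, Polynomial.map_sum, eval_finsetSum]
  have hP1 : P.eval 1 = ∑ T, c T := by simp [heval]
  have hP0 : P ≠ 0 := by
    intro h
    rw [h, eval_zero] at hP1
    exact hpos.ne hP1
  have hmap0 : P.map (algebraMap ℝ ℂ) ≠ 0 :=
    (Polynomial.map_ne_zero_iff (algebraMap ℝ ℂ).injective).2 hP0
  have hsplit : P.Splits := by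
    refine Splits.of_splits_map (algebraMap ℝ ℂ) (IsAlgClosed.splits _) fun s hs => ?_
    have hroot : ∑ T, (c T : ℂ) * s ^ a T = 0 := by
      rw [← hevalC]
      exact (mem_roots hmap0).1 hs
    have him : s.im = 0 := by
      rcases lt_trichotomy s.im 0 with h | h | h
      · refine absurd ?_ (hst (starRingEnd ℂ s) (by simpa using h))
        have := congrArg (starRingEnd ℂ) hroot
        simpa using this
      · exact h
      · exact absurd hroot (hst s h)
    exact ⟨s.re, Complex.ext (by simp) (by simpa using him.symm)⟩
  have hroots : ∀ r ∈ P.roots, r ≤ 0 := by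
    intro r hr
    by_contra! h
    have h1 : ∑ T, c T * r ^ a T = 0 := by
      rw [← heval]
      exact (mem_roots hP0).1 hr
    rw [Finset.sum_eq_zero_iff_of_nonneg fun T _ => mul_nonneg (hc T) (by positivity)] at h1
    refine hpos.ne' (Finset.sum_eq_zero fun T hT => ?_)
    rcases mul_eq_zero.1 (h1 T hT) with h2 | h2
    · exact h2
    · exact absurd h2 (by positivity)
  -- A root r ≤ 0 gives X - r = (1 - r)((1 - p) + pX) with p = 1/(1 - r).
  refine ⟨P.roots.map fun r => 1 / (1 - r), ?_, ?_, ?_⟩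
  · intro p hp
    obtain ⟨r, hr, rfl⟩ := Multiset.mem_map.1 hp
    have := hroots r hr
    refine ⟨by apply div_nonneg <;> linarith, ?_⟩
    rw [div_le_one (by linarith)]
    linarith
  · have key : ∀ s : Multiset ℝ, (∀ r ∈ s, r ≤ 0) → (s.map fun r => X - C r).prod =
        C ((s.map fun r => 1 - r).prod) * ((s.map fun r => 1 / (1 - r)).map fun p =>
          C (1 - p) + C p * X).prod := by
      intro s
      induction s using Multiset.induction with
      | empty => simp
      | cons r s ih =>
        intro h
        have hr := h r (by simp)
        simp only [Multiset.map_cons, Multiset.prod_cons]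
        rw [ih fun x hx => h x (by simp [hx])]
        have h1 : X - C r = C (1 - r) * (C (1 - 1 / (1 - r)) + C (1 / (1 - r)) * X) := by
          rw [mul_add, ← mul_assoc, ← C_mul, ← C_mul]
          have h2 : (1 - r) * (1 - 1 / (1 - r)) = -r := by
            have : (1 - r) ≠ 0 := by linarith
            field_simp
            ring
          have h3 : (1 - r) * (1 / (1 - r)) = 1 := by
            have : (1 - r) ≠ 0 := by linarith
            field_simp
          rw [h2, h3, C_neg, C_1]
          ring
        rw [h1, C_mul]
        ring
    conv_lhs => rw [hsplit.eq_prod_roots]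
    rw [key _ hroots, ← mul_assoc, ← C_mul, ← hP1, hsplit.eval_eq_prod_roots]
  -- The mean is the logarithmic derivative at 1, which is the sum of 1/(1 - r).
  · have h := hsplit.eval_derivative_eq_eval_mul_sum (x := 1) (by rw [hP1]; exact hpos.ne')
    rw [hP1] at h
    rw [← h, hP]
    simp [eval_finsetSum, derivative_X_pow]

end Factorization

/-! ### Mass of a weight after a uniform field -/

section Tilting

variable {m : ℕ} {w : Finset (Fin m) → ℝ}

theorem IsStableWeight.sum_pow_card_inter_ne_zero (hw : IsStableWeight w) (Y : Finset (Fin m))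
    (s : ℂ) (hs : 0 < s.im) : ∑ T, (w T : ℂ) * s ^ (T ∩ Y).card ≠ 0 := by
  have h := hw.stableOn Y (fun _ => s) fun _ => hs
  simpa only [monoSum, prod_pow_indicatorExponent, Finset.prod_const] using h

theorem exists_bernoulli_of_isStableWeight (hw : IsStableWeight w) (Y : Finset (Fin m)) :
    ∃ l : Multiset ℝ, (∀ p ∈ l, 0 ≤ p ∧ p ≤ 1) ∧ average w Y = l.sum ∧
      ∀ t, ∑ T, tilt w (field Y t) T = (∑ T, w T) * (l.map fun p => 1 - p + p * t).prod := by
  obtain ⟨l, hl, h1, h2⟩ := exists_bernoulli_factorization hw.nonneg hw.mass_pos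
    (fun T => (T ∩ Y).card) (hw.sum_pow_card_inter_ne_zero Y)
  refine ⟨l, hl, ?_, fun t => ?_⟩
  · rw [average, h2, mul_div_cancel_left₀ _ hw.mass_pos.ne']
  · have h3 := congrArg (Polynomial.eval t) h1
    simpa [Polynomial.eval_finsetSum, Polynomial.eval_multiset_prod, tilt_field] using h3

theorem mass_mul_le_mass_tilt (hw : IsStableWeight w) (Y : Finset (Fin m)) {t : ℝ} (ht : 1 ≤ t)
    (κ : ℕ) {δ : ℝ} (hδ : δ ≤ 1) (h : (κ : ℝ) - 1 + δ ≤ average w Y) :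
    (∑ T, w T) * (δ * t ^ κ) ≤ ∑ T, tilt w (field Y t) T := by
  obtain ⟨l, hl, h1, h2⟩ := exists_bernoulli_of_isStableWeight hw Y
  rw [h2]
  exact mul_le_mul_of_nonneg_left (mul_pow_le_prod l hl ht κ hδ (h1 ▸ h)) hw.mass_pos.le

theorem mass_mul_le_mass_tilt_of_le_one (hw : IsStableWeight w) (Y : Finset (Fin m)) {t : ℝ}
    (ht0 : 0 < t) (ht : t ≤ 1) (κ : ℕ) {ε : ℝ} (hε : ε ≤ 1) (h : average w Y ≤ κ + 1 - ε) :
    (∑ T, w T) * (ε * t ^ κ) ≤ ∑ T, tilt w (field Y t) T := by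
  obtain ⟨l, hl, h1, h2⟩ := exists_bernoulli_of_isStableWeight hw Y
  rw [h2]
  exact mul_le_mul_of_nonneg_left (mul_pow_le_prod_of_le_one l hl ht0 ht κ hε (h1 ▸ h))
    hw.mass_pos.le

end Tilting

/-! ### Capacity bound for several blocks -/

section Blocks

variable {m n : ℕ} {B : Fin n → Finset (Fin m)}

/-- The external field with value `x i` on the block `B i` for `i ∈ S`, and `1` elsewhere. -/
def blockField (B : Fin n → Finset (Fin m)) (S : Finset (Fin n)) (x : Fin n → ℝ) (e : Fin m) : ℝ :=
  ∏ i ∈ S, field (B i) (x i) e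

theorem field_pos {Y : Finset (Fin m)} {t : ℝ} (ht : 0 < t) (e : Fin m) : 0 < field Y t e := by
  unfold field
  split_ifs <;> linarith

theorem field_mul (Y : Finset (Fin m)) (s t : ℝ) (e : Fin m) :
    field Y s e * field Y t e = field Y (s * t) e := by
  unfold field
  split_ifs <;> simp

theorem field_one (Y : Finset (Fin m)) (e : Fin m) : field Y 1 e = 1 := by
  simp [field]

theorem field_biUnion (hB : Pairwise fun i j => Disjoint (B i) (B j)) (S : Finset (Fin n))
    (t : ℝ) (e : Fin m) : field (S.biUnion B) t e = ∏ i ∈ S, field (B i) t e := by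
  induction S using Finset.induction with
  | empty => simp [field]
  | insert i S hi ih =>
    rw [Finset.prod_insert hi, ← ih, Finset.biUnion_insert]
    unfold field
    by_cases h1 : e ∈ B i
    · have h2 : e ∉ S.biUnion B := by
        intro h2
        obtain ⟨j, hj, hej⟩ := Finset.mem_biUnion.1 h2
        have hij : i ≠ j := fun h => hi (h ▸ hj)
        exact Finset.disjoint_left.1 (hB hij) h1 hej
      rw [if_pos (Finset.mem_union_left _ h1), if_pos h1, if_neg h2, mul_one]
    · by_cases h2 : e ∈ S.biUnion B
      · rw [if_pos (Finset.mem_union_right _ h2), if_neg h1, if_pos h2, one_mul]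
      · rw [if_neg, if_neg h1, if_neg h2, one_mul]
        rw [Finset.mem_union]
        exact not_or.2 ⟨h1, h2⟩

/-- The value at `i₀` is factored out as a uniform field on the whole union; the ratio at `i₀` is
then 1, so that block drops out. -/
theorem blockField_eq_mul (hB : Pairwise fun i j => Disjoint (B i) (B j)) {S : Finset (Fin n)}
    {x : Fin n → ℝ} {i₀ : Fin n} (hi₀ : i₀ ∈ S) (h0 : x i₀ ≠ 0) :
    blockField B S x = fun e => field (S.biUnion B) (x i₀) e *
      blockField B (S.erase i₀) (fun i => x i / x i₀) e := by
  funext e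
  rw [field_biUnion hB, blockField, blockField]
  have h1 : ∏ i ∈ S.erase i₀, field (B i) (x i / x i₀) e =
      ∏ i ∈ S, field (B i) (x i / x i₀) e := by
    rw [← Finset.mul_prod_erase S _ hi₀, div_self h0, field_one, one_mul]
  rw [h1, ← Finset.prod_mul_distrib]
  refine Finset.prod_congr rfl fun i _ => ?_
  rw [field_mul, mul_div_cancel₀ _ h0]

theorem prod_pow_eq_mul {S : Finset (Fin n)} {x : Fin n → ℝ} {i₀ : Fin n} (hi₀ : i₀ ∈ S)
    (h0 : x i₀ ≠ 0) (κ : Fin n → ℕ) :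
    ∏ i ∈ S, x i ^ κ i = x i₀ ^ (∑ i ∈ S, κ i) * ∏ i ∈ S.erase i₀, (x i / x i₀) ^ κ i := by
  have h1 : ∏ i ∈ S.erase i₀, (x i / x i₀) ^ κ i = ∏ i ∈ S, (x i / x i₀) ^ κ i := by
    rw [← Finset.mul_prod_erase S _ hi₀, div_self h0, one_pow, one_mul]
  rw [h1, ← Finset.prod_pow_eq_pow_sum, ← Finset.prod_mul_distrib]
  refine Finset.prod_congr rfl fun i _ => ?_
  rw [← mul_pow, mul_div_cancel₀ _ h0]

/-- Lower bound on the mass after raising the external field on a family of blocks. -/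
theorem mass_mul_le_mass_blockField (hB : Pairwise fun i j => Disjoint (B i) (B j))
    (κ : Fin n → ℕ) {δ : ℕ → ℝ} (hδ0 : ∀ k, 0 ≤ δ k) (hδ1 : ∀ k, δ k ≤ 1)
    (S : Finset (Fin n)) {w : Finset (Fin m) → ℝ} (hw : IsStableWeight w) {x : Fin n → ℝ}
    (hx : ∀ i ∈ S, 1 ≤ x i)
    (h : ∀ S' ⊆ S, S'.Nonempty →
      ((∑ i ∈ S', κ i : ℕ) : ℝ) - 1 + δ S'.card ≤ average w (S'.biUnion B)) :
    (∑ T, w T) * ((∏ k ∈ Finset.Icc 1 S.card, δ k) * ∏ i ∈ S, x i ^ κ i) ≤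
      ∑ T, tilt w (blockField B S x) T := by
  induction hs : S.card generalizing S w x with
  | zero =>
    rw [Finset.card_eq_zero] at hs
    subst hs
    simp [tilt, blockField]
  | succ k ih =>
    have hne : S.Nonempty := by
      rw [← Finset.card_pos]
      omega
    -- Choosing the minimum keeps all remaining ratios at least 1. The uniform field on the union
    -- only raises averages of sub-unions, so the hypotheses persist.
    obtain ⟨i₀, hi₀, hmin⟩ := S.exists_min_image x hne
    have hx0 := hx i₀ hi₀
    have hpos : 0 < x i₀ := by linarith
    have hw' := hw.tilt_field (S.biUnion B) hpos
    have hcard : (S.erase i₀).card = k := by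
      rw [Finset.card_erase_of_mem hi₀, hs]
      rfl
    have h1 := mass_mul_le_mass_tilt hw (S.biUnion B) hx0 (∑ i ∈ S, κ i) (hδ1 S.card)
      (h S subset_rfl hne)
    have h2 := ih (S.erase i₀) hw' (x := fun i => x i / x i₀) (fun i hi => by
        rw [le_div_iff₀ hpos, one_mul]
        exact hmin i (Finset.mem_of_mem_erase hi))
      (fun S' hS' hne' => by
        have hS'' := hS'.trans (Finset.erase_subset i₀ S)
        exact (h S' hS'' hne').trans
          (average_le_average_tilt hw (Finset.biUnion_subset_biUnion_of_subset_left B hS'') hx0))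
      hcard
    rw [tilt_tilt, ← blockField_eq_mul hB hi₀ hpos.ne'] at h2
    refine le_trans ?_ h2
    rw [prod_pow_eq_mul hi₀ hpos.ne', Finset.prod_Icc_succ_top (by omega)]
    rw [hs] at h1
    have h3 : 0 ≤ (∏ j ∈ Finset.Icc 1 k, δ j) * ∏ i ∈ S.erase i₀, (x i / x i₀) ^ κ i := by
      refine mul_nonneg (Finset.prod_nonneg fun j _ => hδ0 j) (Finset.prod_nonneg fun i hi => ?_)
      have := hx i (Finset.mem_of_mem_erase hi)
      positivity
    calc _ = (∑ T, w T) * (δ (k + 1) * x i₀ ^ ∑ i ∈ S, κ i) *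
          ((∏ j ∈ Finset.Icc 1 k, δ j) * ∏ i ∈ S.erase i₀, (x i / x i₀) ^ κ i) := by ring
      _ ≤ _ := mul_le_mul_of_nonneg_right h1 h3

/-- Lower bound on the mass after lowering the external field on a family of blocks. -/
theorem mass_mul_le_mass_blockField_of_le_one (hB : Pairwise fun i j => Disjoint (B i) (B j))
    (κ : Fin n → ℕ) {ε : ℕ → ℝ} (hε0 : ∀ k, 0 ≤ ε k) (hε1 : ∀ k, ε k ≤ 1)
    (S : Finset (Fin n)) {w : Finset (Fin m) → ℝ} (hw : IsStableWeight w) {x : Fin n → ℝ}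
    (hx0 : ∀ i ∈ S, 0 < x i) (hx : ∀ i ∈ S, x i ≤ 1)
    (h : ∀ S' ⊆ S, S'.Nonempty →
      average w (S'.biUnion B) ≤ ((∑ i ∈ S', κ i : ℕ) : ℝ) + 1 - ε S'.card) :
    (∑ T, w T) * ((∏ k ∈ Finset.Icc 1 S.card, ε k) * ∏ i ∈ S, x i ^ κ i) ≤
      ∑ T, tilt w (blockField B S x) T := by
  induction hs : S.card generalizing S w x with
  | zero =>
    rw [Finset.card_eq_zero] at hs
    subst hs
    simp [tilt, blockField]
  | succ k ih =>
    have hne : S.Nonempty := by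
      rw [← Finset.card_pos]
      omega
    -- Dually, the maximum keeps the remaining ratios at most 1, and averages of sub-unions only
    -- fall.
    obtain ⟨i₀, hi₀, hmax⟩ := S.exists_max_image x hne
    have hpos := hx0 i₀ hi₀
    have hw' := hw.tilt_field (S.biUnion B) hpos
    have hcard : (S.erase i₀).card = k := by
      rw [Finset.card_erase_of_mem hi₀, hs]
      rfl
    have h1 := mass_mul_le_mass_tilt_of_le_one hw (S.biUnion B) hpos (hx i₀ hi₀)
      (∑ i ∈ S, κ i) (hε1 S.card) (h S subset_rfl hne)
    have h2 := ih (S.erase i₀) hw' (x := fun i => x i / x i₀)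
      (fun i hi => div_pos (hx0 i (Finset.mem_of_mem_erase hi)) hpos)
      (fun i hi => by
        rw [div_le_one hpos]
        exact hmax i (Finset.mem_of_mem_erase hi))
      (fun S' hS' hne' => by
        have hS'' := hS'.trans (Finset.erase_subset i₀ S)
        exact (average_tilt_le_average hw (Finset.biUnion_subset_biUnion_of_subset_left B hS'')
          hpos (hx i₀ hi₀)).trans (h S' hS'' hne'))
      hcard
    rw [tilt_tilt, ← blockField_eq_mul hB hi₀ hpos.ne'] at h2
    refine le_trans ?_ h2
    rw [prod_pow_eq_mul hi₀ hpos.ne', Finset.prod_Icc_succ_top (by omega)]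
    rw [hs] at h1
    have h3 : 0 ≤ (∏ j ∈ Finset.Icc 1 k, ε j) * ∏ i ∈ S.erase i₀, (x i / x i₀) ^ κ i := by
      refine mul_nonneg (Finset.prod_nonneg fun j _ => hε0 j) (Finset.prod_nonneg fun i hi => ?_)
      have := hx0 i (Finset.mem_of_mem_erase hi)
      positivity
    calc _ = (∑ T, w T) * (ε (k + 1) * x i₀ ^ ∑ i ∈ S, κ i) *
          ((∏ j ∈ Finset.Icc 1 k, ε j) * ∏ i ∈ S.erase i₀, (x i / x i₀) ^ κ i) := by ring
      _ ≤ _ := mul_le_mul_of_nonneg_right h1 h3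

theorem tilt_blockField_univ (w : Finset (Fin m) → ℝ) (x : Fin n → ℝ) (T : Finset (Fin m)) :
    tilt w (blockField B Finset.univ x) T = w T * ∏ i, x i ^ (T ∩ B i).card := by
  unfold tilt blockField
  rw [Finset.prod_comm]
  simp only [prod_field]

/-- The capacity bound: lower bound on the generating function of the block counts in terms of
the averages over unions of blocks. -/
theorem exists_capacity_bound (hB : Pairwise fun i j => Disjoint (B i) (B j))
    (κ : Fin n → ℕ) {δ ε : ℕ → ℝ} (hδ0 : ∀ k, 0 ≤ δ k) (hδ1 : ∀ k, δ k ≤ 1)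
    (hε0 : ∀ k, 0 ≤ ε k) (hε1 : ∀ k, ε k ≤ 1) {w : Finset (Fin m) → ℝ} (hw : IsStableWeight w)
    (hδ : ∀ S : Finset (Fin n), S.Nonempty →
      ((∑ i ∈ S, κ i : ℕ) : ℝ) - 1 + δ S.card ≤ average w (S.biUnion B))
    (hε : ∀ S : Finset (Fin n), S.Nonempty →
      average w (S.biUnion B) ≤ ((∑ i ∈ S, κ i : ℕ) : ℝ) + 1 - ε S.card)
    {x : Fin n → ℝ} (hx : ∀ i, 0 < x i) :
    ∃ l ≤ n, (∑ T, w T) * (((∏ k ∈ Finset.Icc 1 l, ε k) * ∏ k ∈ Finset.Icc 1 (n - l), δ k) *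
      ∏ i, x i ^ κ i) ≤ ∑ T, w T * ∏ i, x i ^ (T ∩ B i).card := by
  set S : Finset (Fin n) := Finset.univ.filter fun i => 1 ≤ x i with hS
  have hSc : n - Sᶜ.card = S.card := by
    have := S.card_compl_add_card
    rw [Fintype.card_fin] at this
    omega
  have hle : Sᶜ.card ≤ n := by
    simpa using Finset.card_le_univ Sᶜ
  refine ⟨Sᶜ.card, hle, ?_⟩
  have hpos : ∀ e, 0 < blockField B S x e := fun e =>
    Finset.prod_pos fun i _ => field_pos (hx i) e
  have h1 := mass_mul_le_mass_blockField hB κ hδ0 hδ1 S hw (x := x)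
    (fun i hi => (Finset.mem_filter.1 hi).2) fun S' _ => hδ S'
  -- The blocks in `Sᶜ` are lowered after those in `S` have been raised; by negative correlation the
  -- raising did not increase their averages, so the bounds `hε` still apply.
  have h2 := mass_mul_le_mass_blockField_of_le_one hB κ hε0 hε1 Sᶜ (hw.tilt hpos) (x := x)
    (fun i _ => hx i) (fun i hi => by
      have : ¬ 1 ≤ x i := by simpa [hS] using hi
      linarith) fun S' hS' hne => by
      refine le_trans (average_tilt_le_of_disjoint hw (fun e => ?_) fun e he => ?_) (hε S' hne)
      · calc (1 : ℝ) = ∏ i ∈ S, 1 := by simp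
          _ ≤ _ := Finset.prod_le_prod (fun _ _ => zero_le_one) fun i hi => by
            unfold field
            split_ifs
            · exact (Finset.mem_filter.1 hi).2
            · exact le_rfl
      · refine Finset.prod_eq_one fun i hi => ?_
        obtain ⟨j, hj, hej⟩ := Finset.mem_biUnion.1 he
        have hij : i ≠ j := by
          rintro rfl
          exact Finset.mem_compl.1 (hS' hj) hi
        unfold field
        rw [if_neg]
        exact fun hei => Finset.disjoint_left.1 (hB hij) hei hej
  have h3 : tilt (tilt w (blockField B S x)) (blockField B Sᶜ x) =
      fun T => w T * ∏ i, x i ^ (T ∩ B i).card := by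
    funext T
    rw [← tilt_blockField_univ, tilt_tilt]
    congr 1
    funext e
    exact Finset.prod_mul_prod_compl S _
  rw [h3] at h2
  refine le_trans ?_ h2
  rw [hSc, ← Finset.prod_mul_prod_compl S fun i => x i ^ κ i]
  have h4 : 0 ≤ (∏ k ∈ Finset.Icc 1 Sᶜ.card, ε k) * ∏ i ∈ Sᶜ, x i ^ κ i :=
    mul_nonneg (Finset.prod_nonneg fun k _ => hε0 k)
      (Finset.prod_nonneg fun i _ => pow_nonneg (hx i).le _)
  calc _ = (∑ T, w T) * ((∏ k ∈ Finset.Icc 1 S.card, δ k) * ∏ i ∈ S, x i ^ κ i) *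
        ((∏ k ∈ Finset.Icc 1 Sᶜ.card, ε k) * ∏ i ∈ Sᶜ, x i ^ κ i) := by ring
    _ ≤ _ := mul_le_mul_of_nonneg_right h1 h4

end Blocks

/-! ### Log-concavity and the univariate coefficient bound -/

section LogConcave

open Polynomial

/-- Log-concavity without internal zeros, for nonnegative sequences. -/
structure IsLogConcaveSeq (L : ℕ → ℝ) : Prop where
  nonneg : ∀ k, 0 ≤ L k
  mul_le : ∀ i j, i ≤ j → L i * L (j + 1) ≤ L (i + 1) * L j

/-- For L k = k! q_k this recursion is multiplication of q by a + bX. The terms in a², ab and b² are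
compared separately. -/
theorem IsLogConcaveSeq.step {L M : ℕ → ℝ} (hL : IsLogConcaveSeq L) {a b : ℝ} (ha : 0 ≤ a)
    (hb : 0 ≤ b) (h0 : M 0 = a * L 0)
    (hs : ∀ k : ℕ, M (k + 1) = a * L (k + 1) + b * ((k + 1 : ℕ) : ℝ) * L k) :
    IsLogConcaveSeq M where
  nonneg k := by
    cases k with
    | zero => rw [h0]; exact mul_nonneg ha (hL.nonneg 0)
    | succ k =>
      rw [hs]
      have := hL.nonneg k
      have := hL.nonneg (k + 1)
      positivity
  mul_le i j hij := by
    rcases hij.eq_or_lt with rfl | hij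
    · rw [mul_comm]
    obtain ⟨j, rfl⟩ : ∃ k, j = k + 1 := ⟨j - 1, by omega⟩
    have hab : 0 ≤ a * b := mul_nonneg ha hb
    have haa : 0 ≤ a * a := mul_nonneg ha ha
    have hbb : 0 ≤ b * b := mul_nonneg hb hb
    cases i with
    | zero =>
      rw [h0, hs, hs, hs]
      have h1 := mul_le_mul_of_nonneg_left (hL.mul_le 0 (j + 1) (by omega)) haa
      have h2 := mul_le_mul_of_nonneg_left (hL.mul_le 0 j (by omega)) hab
      have h3 : 0 ≤ b * b * (L 0 * ((j + 1 : ℕ) * L j)) :=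
        mul_nonneg hbb (mul_nonneg (hL.nonneg 0) (mul_nonneg (Nat.cast_nonneg _) (hL.nonneg j)))
      have h4 := mul_le_mul_of_nonneg_right h2 (Nat.cast_nonneg (α := ℝ) (j + 1))
      push_cast at *
      linarith
    | succ i =>
      rw [hs, hs, hs, hs]
      have hj : (i : ℝ) + 1 ≤ j := by exact_mod_cast (by omega : i + 1 ≤ j)
      have hi0 : (0 : ℝ) ≤ i := Nat.cast_nonneg _
      have h1 := mul_le_mul_of_nonneg_left (hL.mul_le (i + 1) (j + 1) (by omega)) haa
      have h2 := hL.mul_le (i + 1) j (by omega)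
      have h3 := hL.mul_le i (j + 1) (by omega)
      have h4 := hL.mul_le i j (by omega)
      -- After cancellation, both products on the left are at most L (i+2) * L j, and their weights
      -- j - i and i + 1 add up to j + 1.
      have h5 : a * b * (((j : ℝ) - i) * (L (i + 1) * L (j + 1)) +
          (i + 1) * (L i * L (j + 1 + 1))) ≤ a * b * ((j + 1) * (L (i + 1 + 1) * L j)) := by
        apply mul_le_mul_of_nonneg_left _ hab
        have := mul_le_mul_of_nonneg_left h2 (show (0 : ℝ) ≤ j - i by linarith)
        have := mul_le_mul_of_nonneg_left (h3.trans h2) (show (0 : ℝ) ≤ i + 1 by linarith)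
        linarith
      have h6 : b * b * ((i + 1) * (j + 2) * (L i * L (j + 1))) ≤
          b * b * ((i + 2) * (j + 1) * (L (i + 1) * L j)) := by
        apply mul_le_mul_of_nonneg_left _ hbb
        apply mul_le_mul (by nlinarith) h4 (mul_nonneg (hL.nonneg _) (hL.nonneg _))
        positivity
      push_cast at *
      linarith

theorem isLogConcaveSeq_bernoulli (l : Multiset ℝ) (hl : ∀ p ∈ l, 0 ≤ p ∧ p ≤ 1) :
    IsLogConcaveSeq fun k =>
      (k.factorial : ℝ) * ((l.map fun p => C (1 - p) + C p * X).prod : ℝ[X]).coeff k := by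
  induction l using Multiset.induction with
  | empty =>
    have h : ∀ k : ℕ, 0 < k → ((k.factorial : ℝ) *
        (((0 : Multiset ℝ).map fun p => C (1 - p) + C p * X).prod : ℝ[X]).coeff k) = 0 := by
      intro k hk
      simp [coeff_one, hk.ne']
    refine ⟨fun k => ?_, fun i j hij => ?_⟩
    · simp only [Multiset.map_zero, Multiset.prod_zero, coeff_one]
      split_ifs <;> positivity
    · rw [h (j + 1) (by omega), h (i + 1) (by omega), mul_zero, zero_mul]
  | cons p l ih =>
    obtain ⟨hp0, hp1⟩ := hl p (by simp)
    refine (ih fun q hq => hl q (by simp [hq])).step (a := 1 - p) (b := p) (by linarith) hp0 ?_ ?_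
    · simp [add_mul, mul_assoc]
    · intro k
      simp only [Multiset.map_cons, Multiset.prod_cons, add_mul, mul_assoc, coeff_add, coeff_C_mul,
        coeff_X_mul, Nat.factorial_succ]
      push_cast
      ring

/-- The Poisson probability of the value `κ` at mean `κ`. -/
noncomputable def poissonMode (κ : ℕ) : ℝ := (κ : ℝ) ^ κ * Real.exp (-(κ : ℝ)) / κ.factorial

theorem poissonMode_pos (κ : ℕ) : 0 < poissonMode κ := by
  unfold poissonMode
  have : (0 : ℝ) < (κ : ℝ) ^ κ := by
    cases κ with
    | zero => simp
    | succ k => positivity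
  positivity

theorem poissonMode_le_one (κ : ℕ) : poissonMode κ ≤ 1 := by
  have h := Real.pow_div_factorial_le_exp (κ : ℝ) κ.cast_nonneg κ
  rw [poissonMode, mul_div_right_comm]
  calc _ ≤ Real.exp κ * Real.exp (-κ) := mul_le_mul_of_nonneg_right h (Real.exp_pos _).le
    _ = 1 := by rw [← Real.exp_add]; simp

/-- The univariate coefficient bound: a coefficient of a polynomial with log-concave factorially
weighted coefficients in terms of its capacity. -/
theorem poissonMode_mul_le_coeff {q : ℝ[X]}
    (hq : IsLogConcaveSeq fun k => (k.factorial : ℝ) * q.coeff k) (κ : ℕ) {A : ℝ} (hA : 0 ≤ A)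
    (h : ∀ t : ℝ, 0 < t → A * t ^ κ ≤ q.eval t) : poissonMode κ * A ≤ q.coeff κ := by
  set L : ℕ → ℝ := fun k => (k.factorial : ℝ) * q.coeff k with hL
  have hfac : ∀ k : ℕ, (0 : ℝ) < k.factorial := fun k => by exact_mod_cast k.factorial_pos
  have hzero : ∀ k, L k = 0 → q.coeff k = 0 := fun k hk => by
    rcases mul_eq_zero.1 hk with h1 | h1
    · exact absurd h1 (hfac k).ne'
    · exact h1
  suffices hcases : A ≤ q.coeff κ ∨ poissonMode κ * A ≤ q.coeff κ by
    rcases hcases with h1 | h1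
    · exact (mul_le_of_le_one_left hA (poissonMode_le_one κ)).trans h1
    · exact h1
  -- With no terms above κ, divide by t ^ κ and let t = 1/u tend to infinity.
  have htop : (∀ j, κ < j → L j = 0) → A ≤ q.coeff κ := by
    intro hj
    have hdeg : q.natDegree < κ + 1 := by
      rw [Nat.lt_succ_iff, natDegree_le_iff_coeff_eq_zero]
      exact fun j hj' => hzero j (hj j hj')
    have hcont : Continuous fun u : ℝ => ∑ j ∈ Finset.range (κ + 1), q.coeff j * u ^ (κ - j) := by
      fun_prop
    have hlim := (hcont.tendsto 0).mono_left (nhdsWithin_le_nhds (s := Set.Ioi 0))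
    have hval : ∑ j ∈ Finset.range (κ + 1), q.coeff j * (0 : ℝ) ^ (κ - j) = q.coeff κ := by
      rw [Finset.sum_eq_single κ]
      · simp
      · intro j hj hne
        rw [zero_pow, mul_zero]
        have := Finset.mem_range.1 hj
        omega
      · simp
    rw [hval] at hlim
    refine ge_of_tendsto hlim ?_
    filter_upwards [self_mem_nhdsWithin] with u hu
    have hu : 0 < u := hu
    have h1 := h u⁻¹ (inv_pos.2 hu)
    rw [eval_eq_sum_range' hdeg] at h1
    have h2 := mul_le_mul_of_nonneg_right h1 (pow_nonneg hu.le κ)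
    rw [mul_assoc, ← mul_pow, inv_mul_cancel₀ hu.ne', one_pow, mul_one, Finset.sum_mul] at h2
    refine h2.trans_eq (Finset.sum_congr rfl fun j hj => ?_)
    have hjκ : j ≤ κ := by
      have := Finset.mem_range.1 hj
      omega
    rw [mul_assoc, ← pow_sub_mul_pow u hjκ, inv_pow]
    field_simp
  -- With no terms below κ, divide by t ^ κ and let t tend to 0.
  have hlow : (∀ i, i < κ → L i = 0) → A ≤ q.coeff κ := by
    intro hi
    obtain ⟨p, rfl⟩ := X_pow_dvd_iff.2 fun d hd => hzero d (hi d hd)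
    have hlim := (p.continuous.tendsto 0).mono_left (nhdsWithin_le_nhds (s := Set.Ioi 0))
    have hval : (X ^ κ * p).coeff κ = p.eval 0 := by
      have := coeff_X_pow_mul p κ 0
      rw [zero_add] at this
      rw [this, coeff_zero_eq_eval_zero]
    rw [hval]
    refine ge_of_tendsto hlim ?_
    filter_upwards [self_mem_nhdsWithin] with u hu
    have hu : 0 < u := hu
    have h1 := h u hu
    rw [eval_mul, eval_pow, eval_X, mul_comm A] at h1
    exact le_of_mul_le_mul_left h1 (pow_pos hu κ)
  have hprop : ∀ i k, i ≤ k → 0 < L i → L k = 0 → ∀ j, k ≤ j → L j = 0 := by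
    intro i k hik hi hk j hkj
    induction j, hkj using Nat.le_induction with
    | base => exact hk
    | succ j hkj ih =>
      have h1 := hq.mul_le i j (hik.trans hkj)
      have h2 := hq.nonneg (j + 1)
      change L i * L (j + 1) ≤ L (i + 1) * L j at h1
      rw [ih, mul_zero] at h1
      exact le_antisymm (by nlinarith) h2
  rcases (hq.nonneg κ).eq_or_lt with hκ | hκ
  · left
    by_cases hex : ∃ i, i < κ ∧ 0 < L i
    · obtain ⟨i, hi, hLi⟩ := hex
      exact htop fun j hj => hprop i κ hi.le hLi hκ.symm j hj.le
    · push Not at hex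
      exact hlow fun i hi => le_antisymm (hex i hi) (hq.nonneg i)
  rcases (hq.nonneg (κ + 1)).eq_or_lt with hκ1 | hκ1
  · left
    exact htop fun j hj => hprop κ (κ + 1) (by omega) hκ hκ1.symm j hj
  -- The test point κ/r used below would not be positive for κ = 0.
  rcases Nat.eq_zero_or_pos κ with rfl | hκ0
  · exact Or.inl (hlow fun i hi => absurd hi (by omega))
  right
  change 0 < L κ at hκ
  change 0 < L (κ + 1) at hκ1
  -- Log-concavity gives L j ≤ L κ * r ^ (j - κ) on both sides of κ. Hence q(t) ≤ L κ * r ^ (-κ) *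
  -- exp(rt), and t = κ/r is the optimal test point.
  set r := L (κ + 1) / L κ with hr
  have hrpos : 0 < r := div_pos hκ1 hκ
  have hrL : r * L κ = L (κ + 1) := div_mul_cancel₀ _ hκ.ne'
  clear_value r
  have hup : ∀ d, L (κ + d) ≤ L κ * r ^ d := by
    intro d
    induction d with
    | zero => simp
    | succ d ih =>
      have h1 := hq.mul_le κ (κ + d) (by omega)
      change L κ * L (κ + d + 1) ≤ L (κ + 1) * L (κ + d) at h1
      rw [← hrL] at h1
      have h2 : L (κ + d + 1) ≤ r * L (κ + d) := by
        apply le_of_mul_le_mul_left _ hκ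
        linarith
      calc L (κ + (d + 1)) ≤ r * L (κ + d) := h2
        _ ≤ r * (L κ * r ^ d) := by gcongr
        _ = _ := by ring
  have hdown : ∀ d, d ≤ κ → r ^ d * L (κ - d) ≤ L κ := by
    intro d
    induction d with
    | zero => simp
    | succ d ih =>
      intro hd
      have h1 := hq.mul_le (κ - (d + 1)) κ (by omega)
      change L (κ - (d + 1)) * L (κ + 1) ≤ L (κ - (d + 1) + 1) * L κ at h1
      rw [← hrL, show κ - (d + 1) + 1 = κ - d by omega] at h1
      have h2 : r * L (κ - (d + 1)) ≤ L (κ - d) := by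
        apply le_of_mul_le_mul_right _ hκ
        linarith
      calc r ^ (d + 1) * L (κ - (d + 1)) = r ^ d * (r * L (κ - (d + 1))) := by ring
        _ ≤ r ^ d * L (κ - d) := by gcongr
        _ ≤ _ := ih (by omega)
  have hall : ∀ j, r ^ κ * L j ≤ L κ * r ^ j := by
    intro j
    rcases le_total κ j with hj | hj
    · have h1 := mul_le_mul_of_nonneg_left (hup (j - κ)) (pow_nonneg hrpos.le κ)
      rw [show κ + (j - κ) = j by omega] at h1
      calc _ ≤ _ := h1
        _ = L κ * (r ^ (j - κ) * r ^ κ) := by ring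
        _ = _ := by rw [pow_sub_mul_pow r hj]
    · have h1 := mul_le_mul_of_nonneg_left (hdown (κ - j) (by omega)) (pow_nonneg hrpos.le j)
      rw [show κ - (κ - j) = j by omega] at h1
      calc r ^ κ * L j = r ^ j * (r ^ (κ - j) * L j) := by
            rw [← pow_sub_mul_pow r hj]; ring
        _ ≤ _ := h1
        _ = _ := by ring
  have hκR : (0 : ℝ) < κ := by exact_mod_cast hκ0
  have hev : r ^ κ * q.eval (κ / r) ≤ L κ * Real.exp κ := by
    rw [eval_eq_sum_range, Finset.mul_sum]
    calc ∑ j ∈ Finset.range (q.natDegree + 1), r ^ κ * (q.coeff j * (κ / r) ^ j)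
        ≤ ∑ j ∈ Finset.range (q.natDegree + 1), L κ * ((κ : ℝ) ^ j / j.factorial) := by
          refine Finset.sum_le_sum fun j _ => ?_
          have h1 : q.coeff j = L j / j.factorial := by
            rw [hL]
            dsimp only
            rw [mul_div_cancel_left₀ _ (hfac j).ne']
          have h2 : 0 ≤ (κ / r) ^ j / j.factorial := by positivity
          calc r ^ κ * (q.coeff j * (κ / r) ^ j)
              = (r ^ κ * L j) * ((κ / r) ^ j / j.factorial) := by rw [h1]; ring
            _ ≤ (L κ * r ^ j) * ((κ / r) ^ j / j.factorial) :=
              mul_le_mul_of_nonneg_right (hall j) h2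
            _ = L κ * ((κ : ℝ) ^ j / j.factorial) := by
              rw [div_pow]
              field_simp
      _ ≤ _ := by
          rw [← Finset.mul_sum]
          exact mul_le_mul_of_nonneg_left (Real.sum_le_exp_of_nonneg hκR.le _) hκ.le
  have h1 := h (κ / r) (by positivity)
  have h2 : A * (κ : ℝ) ^ κ ≤ L κ * Real.exp κ := by
    calc A * (κ : ℝ) ^ κ = r ^ κ * (A * (κ / r) ^ κ) := by
          rw [div_pow]
          field_simp
      _ ≤ r ^ κ * q.eval (κ / r) := by gcongr
      _ ≤ _ := hev
  rw [poissonMode, Real.exp_neg, div_mul_eq_mul_div, div_le_iff₀ (hfac κ), mul_assoc, mul_comm,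
    mul_assoc, inv_mul_le_iff₀ (Real.exp_pos _)]
  calc A * (κ : ℝ) ^ κ ≤ L κ * Real.exp κ := h2
    _ = _ := by rw [hL]; ring

end LogConcave

/-! ### Multivariate coefficient bound -/

section Coefficients

variable {ι σ : Type*} [Fintype ι] [DecidableEq σ]

open Polynomial in
/-- The multivariate coefficient bound for stable polynomials in terms of the capacity. -/
theorem prod_poissonMode_mul_le_coefficient (a : ι → σ → ℕ) (κ : σ → ℕ) (R : Finset σ)
    {c : ι → ℝ} (hc : ∀ T, 0 ≤ c T) (hst : StableOn (fun T => (c T : ℂ)) a R) {A : ℝ}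
    (hA : 0 < A) (h : ∀ x : σ → ℝ, (∀ i, 0 < x i) →
      A * ∏ i ∈ R, x i ^ κ i ≤ ∑ T, c T * ∏ i ∈ R, x i ^ a T i) :
    (∏ i ∈ R, poissonMode (κ i)) * A ≤ ∑ T, if ∀ i ∈ R, a T i = κ i then c T else 0 := by
  induction R using Finset.induction generalizing c A with
  | empty => simpa using h 1 (fun _ => zero_lt_one)
  | insert i R hi ih =>
    -- At fixed positive values of the other variables, the univariate bound extracts the power κ i;
    -- the capacity hypothesis passes to the coefficient with the loss of one Poisson factor.
    have key : ∀ x : σ → ℝ, (∀ i, 0 < x i) →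
        poissonMode (κ i) * A * ∏ j ∈ R, x j ^ κ j ≤
          ∑ T, (if a T i = κ i then c T else 0) * ∏ j ∈ R, x j ^ a T j := by
      intro x hx
      set d : ι → ℝ := fun T => c T * ∏ j ∈ R, x j ^ a T j with hd
      have hd0 : ∀ T, 0 ≤ d T := fun T =>
        mul_nonneg (hc T) (Finset.prod_nonneg fun j _ => pow_nonneg (hx j).le _)
      have hAx : 0 < A * ∏ j ∈ R, x j ^ κ j :=
        mul_pos hA (Finset.prod_pos fun j _ => pow_pos (hx j) _)
      have hbound : ∀ t : ℝ, 0 < t → A * (∏ j ∈ R, x j ^ κ j) * t ^ κ i ≤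
          ∑ T, d T * t ^ a T i := by
        intro t ht
        have h1 := h (Function.update x i t) fun j => by
          by_cases hj : j = i
          · subst hj; simpa using ht
          · simpa [hj] using hx j
        have h2 : ∀ b : σ → ℕ, ∏ j ∈ insert i R, Function.update x i t j ^ b j =
            t ^ b i * ∏ j ∈ R, x j ^ b j := by
          intro b
          rw [Finset.prod_insert hi, Function.update_self]
          congr 1
          refine Finset.prod_congr rfl fun j hj => ?_
          rw [Function.update_of_ne]
          rintro rfl
          exact hi hj
        simp only [h2] at h1
        calc _ = _ := by ring
          _ ≤ _ := h1
          _ = _ := Finset.sum_congr rfl fun T _ => by rw [hd]; ring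
      have hdpos : 0 < ∑ T, d T := by
        have := hbound 1 one_pos
        simp only [one_pow, mul_one] at this
        linarith
      -- The positive values `x j` are absorbed by rescaling the variables, which preserves the
      -- upper half-plane; those variables are then set to 1.
      have hdst : StableOn (fun T => (d T : ℂ)) a (insert i R) := by
        intro z hz
        have h1 := hst (fun j => if j = i then z j else (x j : ℂ) * z j) fun j => by
          split_ifs
          · exact hz j
          · simpa using mul_pos (hx j) (hz j)
        convert h1 using 1
        refine Finset.sum_congr rfl fun T _ => ?_
        rw [Finset.prod_insert hi, Finset.prod_insert hi]
        beta_reduce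
        rw [if_pos rfl]
        have h2 : ∏ j ∈ R, (if j = i then z j else (x j : ℂ) * z j) ^ a T j =
            (∏ j ∈ R, (x j : ℂ) ^ a T j) * ∏ j ∈ R, z j ^ a T j := by
          rw [← Finset.prod_mul_distrib]
          refine Finset.prod_congr rfl fun j hj => ?_
          rw [if_neg (fun hji : j = i => hi (hji ▸ hj)), mul_pow]
        rw [h2, hd]
        push_cast
        ring
      have hds := hdst.mono (R' := {i}) (by simp) (by exact_mod_cast hdpos.ne')
      obtain ⟨l, hl, h1, -⟩ := exists_bernoulli_factorization hd0 hdpos (fun T => a T i)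
        fun s hs => by simpa [monoSum] using hds (fun _ => s) fun _ => hs
      set q : ℝ[X] := (l.map fun p => C (1 - p) + C p * X).prod with hq
      have h2 := poissonMode_mul_le_coeff (isLogConcaveSeq_bernoulli l hl) (κ i)
        (A := A * (∏ j ∈ R, x j ^ κ j) / ∑ T, d T) (div_pos hAx hdpos).le fun t ht => by
          have h3 := hbound t ht
          have h4 := congrArg (eval t) h1
          simp only [eval_finsetSum, eval_mul, eval_C, eval_pow, eval_X] at h4
          rw [h4] at h3
          rw [div_mul_eq_mul_div, div_le_iff₀ hdpos, mul_comm (eval t _)]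
          exact h3
      have h3 := congrArg (fun p => p.coeff (κ i)) h1
      simp only [finsetSum_coeff, coeff_C_mul, coeff_X_pow] at h3
      rw [← mul_div_assoc, div_le_iff₀ hdpos] at h2
      calc _ = _ := by ring
        _ ≤ _ := h2
        _ = _ := by rw [mul_comm, ← h3]
        _ = _ := Finset.sum_congr rfl fun T _ => by
          by_cases h4 : a T i = κ i
          · simp [h4, hd]
          · simp [h4, Ne.symm h4]
    have hpos : 0 < poissonMode (κ i) * A := mul_pos (poissonMode_pos _) hA
    have hsum : ∑ T, (if a T i = κ i then (c T : ℂ) else 0) ≠ 0 := by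
      have h1 := key 1 fun _ => zero_lt_one
      simp only [Pi.one_apply, one_pow, Finset.prod_const_one, mul_one] at h1
      have h2 : (((∑ T, if a T i = κ i then c T else 0 : ℝ)) : ℂ) ≠ 0 := by
        exact_mod_cast (hpos.trans_le h1).ne'
      push_cast at h2
      convert h2 using 2 with T
      split_ifs <;> simp
    have hst' := hst.coefficient (Finset.mem_insert_self i R) (κ i) hsum
    rw [Finset.erase_insert hi] at hst'
    have h1 := ih (c := fun T => if a T i = κ i then c T else 0)
      (fun T => by split_ifs; exacts [hc T, le_rfl])
      (by convert hst' using 2 with T; split_ifs <;> simp) hpos key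
    rw [Finset.prod_insert hi]
    calc _ = _ := by ring
      _ ≤ _ := h1
      _ = _ := Finset.sum_congr rfl fun T _ => by
        simp only [Finset.forall_mem_insert]
        by_cases h1 : a T i = κ i <;> by_cases h2 : ∀ j ∈ R, a T j = κ j <;> simp [h1, h2]

end Coefficients

/-! ### Specialization to strongly Rayleigh measures; properties of δ and ε -/

section Main

variable {m n : ℕ} {μ : PMF (Finset (Fin m))} {B : Fin n → Finset (Fin m)} {κ : Fin n → ℕ}

theorem sum_toReal_eq_one (μ : PMF (Finset (Fin m))) : ∑ T, (μ T).toReal = 1 := by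
  rw [← ENNReal.toReal_sum fun T _ => μ.apply_ne_top T, ← tsum_fintype (L := SummationFilter.unconditional _), μ.tsum_coe,
    ENNReal.toReal_one]

theorem IsStronglyRayleigh.isStableWeight (hμ : IsStronglyRayleigh μ) :
    IsStableWeight fun T => (μ T).toReal where
  nonneg T := ENNReal.toReal_nonneg
  mass_pos := by rw [sum_toReal_eq_one]; exact one_pos
  stable := by
    intro z hz
    have h := hμ z hz
    convert h using 1
    rw [generatingPolynomial, map_sum]
    refine Finset.sum_congr rfl fun T _ => ?_
    rw [prod_pow_indicatorExponent, Finset.inter_univ, map_mul, map_prod]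
    simp

/-- All variables in a block are identified with one `z i`; disjointness makes the choice of block
unambiguous. Elements outside the blocks get the dummy value i. -/
theorem stableOn_blocks (hB : Pairwise fun i j => Disjoint (B i) (B j))
    {w : Finset (Fin m) → ℝ} (hw : IsStableWeight w) :
    StableOn (fun T => (w T : ℂ)) (fun T i => (T ∩ B i).card) Finset.univ := by
  classical
  intro z hz
  have h := hw.stableOn (Finset.univ.biUnion B)
    (fun e => if h : ∃ i, e ∈ B i then z h.choose else Complex.I) fun e => by
      split_ifs
      · exact hz _
      · simp
  convert h using 1
  refine Finset.sum_congr rfl fun T _ => ?_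
  rw [prod_pow_indicatorExponent, Finset.inter_biUnion, Finset.prod_biUnion fun i _ j _ hij =>
    (hB hij).mono Finset.inter_subset_right Finset.inter_subset_right]
  congr 1
  refine Finset.prod_congr rfl fun i _ => ?_
  rw [← Finset.prod_const]
  refine Finset.prod_congr rfl fun e he => ?_
  have hei : ∃ i, e ∈ B i := ⟨i, (Finset.mem_inter.1 he).2⟩
  rw [dif_pos hei]
  congr 1
  by_contra hne
  exact Finset.disjoint_left.1 (hB hne) (Finset.mem_inter.1 he).2 hei.choose_spec

theorem deviation_eq (hB : Pairwise fun i j => Disjoint (B i) (B j)) (S : Finset (Fin n)) :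
    deviation μ B κ S =
      average (fun T => (μ T).toReal) (S.biUnion B) - ((∑ i ∈ S, κ i : ℕ) : ℝ) := by
  rw [deviation, average, sum_toReal_eq_one, div_one, expect]
  push_cast
  congr 1
  refine Finset.sum_congr rfl fun T _ => ?_
  congr 1
  rw [Finset.inter_biUnion, Finset.card_biUnion fun i _ j _ hij =>
    (hB hij).mono Finset.inter_subset_right Finset.inter_subset_right]
  push_cast
  rfl

theorem deltaCoeff_le (S : Finset (Fin n)) :
    deltaCoeff μ B κ S.card ≤ 1 + deviation μ B κ S := by
  have h := ciInf_le (Set.finite_range fun S' : {S' : Finset (Fin n) // S'.card = S.card} =>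
    deviation μ B κ S').bddBelow ⟨S, rfl⟩
  rw [deltaCoeff]
  linarith

theorem epsilonCoeff_le (S : Finset (Fin n)) :
    epsilonCoeff μ B κ S.card ≤ 1 - deviation μ B κ S := by
  have h := le_ciSup (Set.finite_range fun S' : {S' : Finset (Fin n) // S'.card = S.card} =>
    deviation μ B κ S').bddAbove ⟨S, rfl⟩
  rw [epsilonCoeff]
  linarith

theorem nonempty_card_eq {k : ℕ} (hk : k ≤ n) : Nonempty {S : Finset (Fin n) // S.card = k} := by
  obtain ⟨S, -, hS⟩ := Finset.exists_subset_card_eq (s := (Finset.univ : Finset (Fin n)))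
    (by simpa using hk)
  exact ⟨⟨S, hS⟩⟩

theorem exists_deltaCoeff_eq {k : ℕ} (hk : k ≤ n) :
    ∃ S : Finset (Fin n), S.card = k ∧ deltaCoeff μ B κ k = 1 + deviation μ B κ S := by
  have := nonempty_card_eq hk
  obtain ⟨S, hS⟩ := exists_eq_ciInf_of_finite
    (f := fun S : {S : Finset (Fin n) // S.card = k} => deviation μ B κ S)
  exact ⟨S, S.2, by rw [deltaCoeff, ← hS]⟩

theorem exists_epsilonCoeff_eq {k : ℕ} (hk : k ≤ n) :
    ∃ S : Finset (Fin n), S.card = k ∧ epsilonCoeff μ B κ k = 1 - deviation μ B κ S := by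
  have := nonempty_card_eq hk
  obtain ⟨S, hS⟩ := exists_eq_ciSup_of_finite
    (f := fun S : {S : Finset (Fin n) // S.card = k} => deviation μ B κ S)
  exact ⟨S, S.2, by rw [epsilonCoeff, ← hS]⟩

/-- The deviation is additive over the elements of `S`. -/
theorem deviation_eq_sum (S : Finset (Fin n)) :
    deviation μ B κ S = ∑ i ∈ S, deviation μ B κ {i} := by
  simp only [deviation, expect, Finset.sum_singleton, Finset.sum_sub_distrib]
  rw [Finset.sum_comm]
  simp only [Finset.mul_sum]

/-- Each singleton deviation survives in all but one of the erased sets. -/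
theorem sum_deviation_erase (S : Finset (Fin n)) :
    ∑ i ∈ S, deviation μ B κ (S.erase i) = ((S.card : ℝ) - 1) * deviation μ B κ S := by
  have h : ∀ i ∈ S, deviation μ B κ (S.erase i) = deviation μ B κ S - deviation μ B κ {i} := by
    intro i hi
    rw [deviation_eq_sum S, deviation_eq_sum (S.erase i), ← Finset.add_sum_erase S _ hi]
    ring
  rw [Finset.sum_congr rfl h, Finset.sum_sub_distrib, Finset.sum_const, ← deviation_eq_sum,
    nsmul_eq_mul]
  ring

/-- The deviation of a (k+1)-set is 1/k times the sum of those of its k-subsets, all positive when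
δ_k > 1. -/
theorem one_lt_deltaCoeff_succ {k : ℕ} (hk0 : 1 ≤ k) (hk : k + 1 ≤ n)
    (h : 1 < deltaCoeff μ B κ k) : 1 < deltaCoeff μ B κ (k + 1) := by
  obtain ⟨S, hS, hS'⟩ := exists_deltaCoeff_eq (μ := μ) (B := B) (κ := κ) hk
  have hpos : 0 < ∑ i ∈ S, deviation μ B κ (S.erase i) := by
    refine Finset.sum_pos (fun i hi => ?_) (Finset.card_pos.1 (by omega))
    have h1 := deltaCoeff_le (μ := μ) (B := B) (κ := κ) (S.erase i)
    rw [Finset.card_erase_of_mem hi, hS, Nat.add_sub_cancel] at h1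
    linarith
  rw [sum_deviation_erase, hS] at hpos
  push_cast at hpos
  rw [add_sub_cancel_right] at hpos
  have : 0 < deviation μ B κ S := pos_of_mul_pos_right hpos (Nat.cast_nonneg k)
  linarith

theorem one_lt_epsilonCoeff_succ {k : ℕ} (hk0 : 1 ≤ k) (hk : k + 1 ≤ n)
    (h : 1 < epsilonCoeff μ B κ k) : 1 < epsilonCoeff μ B κ (k + 1) := by
  obtain ⟨S, hS, hS'⟩ := exists_epsilonCoeff_eq (μ := μ) (B := B) (κ := κ) hk
  have hpos : ∑ i ∈ S, deviation μ B κ (S.erase i) < 0 := by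
    refine Finset.sum_neg (fun i hi => ?_) (Finset.card_pos.1 (by omega))
    have h1 := epsilonCoeff_le (μ := μ) (B := B) (κ := κ) (S.erase i)
    rw [Finset.card_erase_of_mem hi, hS, Nat.add_sub_cancel] at h1
    linarith
  rw [sum_deviation_erase, hS] at hpos
  push_cast at hpos
  rw [add_sub_cancel_right] at hpos
  have : deviation μ B κ S < 0 := by
    by_contra! h2
    have := mul_nonneg (Nat.cast_nonneg (α := ℝ) k) h2
    linarith
  linarith

theorem deltaCoeff_add_epsilonCoeff_le {k : ℕ} (hk : k ≤ n) :
    deltaCoeff μ B κ k + epsilonCoeff μ B κ k ≤ 2 := by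
  obtain ⟨S, rfl, -⟩ := exists_deltaCoeff_eq (μ := μ) (B := B) (κ := κ) hk
  have h1 := deltaCoeff_le (μ := μ) (B := B) (κ := κ) S
  have h2 := epsilonCoeff_le (μ := μ) (B := B) (κ := κ) S
  linarith

end Main

/-! ### Removing the cap at 1 -/

section Truncation

theorem one_lt_of_le {n : ℕ} {δ : ℕ → ℝ}
    (hδ : ∀ k, 1 ≤ k → k + 1 ≤ n → 1 < δ k → 1 < δ (k + 1)) {k j : ℕ} (hk : 1 ≤ k) (hkj : k ≤ j)
    (hj : j ≤ n) (h : 1 < δ k) : 1 < δ j := by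
  induction j, hkj using Nat.le_induction with
  | base => exact h
  | succ j hkj ih => exact hδ j (by omega) hj (ih (by omega))

/-- If `δ` stays above `1` once it exceeds `1`, truncating a product of its initial values at `1`
gives a shorter product. -/
theorem exists_prod_min_one_eq {n : ℕ} {δ : ℕ → ℝ}
    (hδ : ∀ k, 1 ≤ k → k + 1 ≤ n → 1 < δ k → 1 < δ (k + 1)) {r : ℕ} (hr : r ≤ n) :
    ∃ s ≤ r, ∏ k ∈ Finset.Icc 1 r, min 1 (δ k) = ∏ k ∈ Finset.Icc 1 s, δ k ∧
      (s < r → 1 < δ r) := by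
  induction r with
  | zero => exact ⟨0, le_rfl, by simp, by omega⟩
  | succ r ih =>
    obtain ⟨s, hs, h1, h2⟩ := ih (by omega)
    by_cases hgt : 1 < δ (r + 1)
    · refine ⟨s, by omega, ?_, fun _ => hgt⟩
      rw [Finset.prod_Icc_succ_top (by omega), min_eq_left hgt.le, mul_one, h1]
    · have hsr : s = r := by
        by_contra hne
        exact hgt (hδ r (by omega) hr (h2 (by omega)))
      subst hsr
      refine ⟨s + 1, le_rfl, ?_, by omega⟩
      rw [Finset.prod_Icc_succ_top (by omega), Finset.prod_Icc_succ_top (by omega),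
        min_eq_right (not_lt.1 hgt), h1]

theorem prod_Icc_le_prod_Icc {n : ℕ} {ε : ℕ → ℝ} (hε : ∀ k ∈ Finset.Icc 1 n, 0 < ε k)
    (hε1 : ∀ k ∈ Finset.Icc 1 n, ε k ≤ 1) {a b : ℕ} (hab : a ≤ b) (hb : b ≤ n) :
    ∏ k ∈ Finset.Icc 1 b, ε k ≤ ∏ k ∈ Finset.Icc 1 a, ε k := by
  have hmem : ∀ k ∈ Finset.Icc 1 b, k ∈ Finset.Icc 1 n := fun k hk => by
    simp only [Finset.mem_Icc] at *
    omega
  have hsub : Finset.Icc 1 a ⊆ Finset.Icc 1 b := Finset.Icc_subset_Icc le_rfl hab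
  rw [← Finset.prod_sdiff hsub]
  refine mul_le_of_le_one_left (Finset.prod_nonneg fun k hk => (hε k (hmem k (hsub hk))).le) ?_
  refine Finset.prod_le_one (fun k hk => ?_) fun k hk => ?_
  · exact (hε k (hmem k (Finset.mem_sdiff.1 hk).1)).le
  · exact hε1 k (hmem k (Finset.mem_sdiff.1 hk).1)

/-- Capping shortens a product, since the sequences stay above 1 once they exceed it. By `hn` at
most one of them ever exceeds 1; the other is bounded by 1, so lengthening its product to restore
the total length `n` only decreases it. -/
theorem exists_prod_mul_prod_le_truncated {n : ℕ} {δ ε : ℕ → ℝ}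
    (hδ0 : ∀ k ∈ Finset.Icc 1 n, 0 < δ k) (hε0 : ∀ k ∈ Finset.Icc 1 n, 0 < ε k)
    (hδ : ∀ k, 1 ≤ k → k + 1 ≤ n → 1 < δ k → 1 < δ (k + 1))
    (hε : ∀ k, 1 ≤ k → k + 1 ≤ n → 1 < ε k → 1 < ε (k + 1))
    (hn : δ n + ε n ≤ 2) {l : ℕ} (hl : l ≤ n) :
    ∃ s ≤ n, (∏ k ∈ Finset.Icc 1 s, ε k) * ∏ k ∈ Finset.Icc 1 (n - s), δ k ≤
      (∏ k ∈ Finset.Icc 1 l, min 1 (ε k)) * ∏ k ∈ Finset.Icc 1 (n - l), min 1 (δ k) := by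
  obtain ⟨s, hs, h1, h2⟩ := exists_prod_min_one_eq hδ (Nat.sub_le n l)
  obtain ⟨s', hs', h1', h2'⟩ := exists_prod_min_one_eq hε hl
  have hprod : ∀ {ζ : ℕ → ℝ}, (∀ k ∈ Finset.Icc 1 n, 0 < ζ k) → ∀ a ≤ n,
      0 ≤ ∏ k ∈ Finset.Icc 1 a, ζ k := fun h a ha => Finset.prod_nonneg fun k hk =>
    (h k (Finset.Icc_subset_Icc le_rfl ha hk)).le
  have hδn : ∀ k ∈ Finset.Icc 1 n, 1 < δ k → 1 < δ n := fun k hk h =>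
    one_lt_of_le hδ (Finset.mem_Icc.1 hk).1 (Finset.mem_Icc.1 hk).2 le_rfl h
  have hεn : ∀ k ∈ Finset.Icc 1 n, 1 < ε k → 1 < ε n := fun k hk h =>
    one_lt_of_le hε (Finset.mem_Icc.1 hk).1 (Finset.mem_Icc.1 hk).2 le_rfl h
  rw [h1, h1']
  rcases hs.eq_or_lt with rfl | hslt
  · rcases hs'.eq_or_lt with rfl | hslt'
    · exact ⟨s', hl, le_rfl⟩
    · have hgt := hεn l (Finset.mem_Icc.2 ⟨by omega, hl⟩) (h2' hslt')
      refine ⟨s', by omega, mul_le_mul_of_nonneg_left ?_ (hprod hε0 _ (by omega))⟩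
      refine prod_Icc_le_prod_Icc hδ0 (fun k hk => ?_) (by omega) (by omega)
      by_contra! h
      linarith [hδn k hk h]
  · have hgt := hδn (n - l) (Finset.mem_Icc.2 ⟨by omega, by omega⟩) (h2 hslt)
    have hε1 : ∀ k ∈ Finset.Icc 1 n, ε k ≤ 1 := fun k hk => by
      by_contra! h
      linarith [hεn k hk h]
    have hs'l : s' = l := by
      by_contra hne
      have := h2' (by omega)
      linarith [hε1 l (Finset.mem_Icc.2 ⟨by omega, hl⟩)]
    subst hs'l
    refine ⟨n - s, by omega, ?_⟩
    rw [show n - (n - s) = s by omega]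
    exact mul_le_mul_of_nonneg_right (prod_Icc_le_prod_Icc hε0 hε1 (by omega) (by omega))
      (hprod hδ0 _ (by omega))

end Truncation

/-! ### Positivity and the final bound -/

theorem deltaCoeff_pos {m n : ℕ} {μ : PMF (Finset (Fin m))} {B : Fin n → Finset (Fin m)}
    {κ : Fin n → ℕ} (hκ : ∀ S : Finset (Fin n), |deviation μ B κ S| < 1) (k : ℕ) :
    0 < deltaCoeff μ B κ k := by
  by_cases hk : k ≤ n
  · obtain ⟨S, -, hS⟩ := exists_deltaCoeff_eq (μ := μ) (B := B) (κ := κ) hk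
    rw [hS]
    linarith [(abs_lt.1 (hκ S)).1]
  -- For k > n the infimum over the empty family is 0, so the coefficient is 1; positivity for every
  -- k avoids range conditions later.
  · have : IsEmpty {S : Finset (Fin n) // S.card = k} :=
      ⟨fun S => hk (by simpa [S.2] using Finset.card_le_univ S.1)⟩
    rw [deltaCoeff, Real.iInf_of_isEmpty]
    norm_num

theorem epsilonCoeff_pos {m n : ℕ} {μ : PMF (Finset (Fin m))} {B : Fin n → Finset (Fin m)}
    {κ : Fin n → ℕ} (hκ : ∀ S : Finset (Fin n), |deviation μ B κ S| < 1) (k : ℕ) :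
    0 < epsilonCoeff μ B κ k := by
  by_cases hk : k ≤ n
  · obtain ⟨S, -, hS⟩ := exists_epsilonCoeff_eq (μ := μ) (B := B) (κ := κ) hk
    rw [hS]
    linarith [(abs_lt.1 (hκ S)).2]
  · have : IsEmpty {S : Finset (Fin n) // S.card = k} :=
      ⟨fun S => hk (by simpa [S.2] using Finset.card_le_univ S.1)⟩
    rw [epsilonCoeff, Real.iSup_of_isEmpty]
    norm_num

theorem mainTheorem4 {m n : ℕ} (μ : PMF (Finset (Fin m))) (hμ : IsStronglyRayleigh μ)
    (B : Fin n → Finset (Fin m)) (hB : Pairwise fun i j => Disjoint (B i) (B j))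
    (κ : Fin n → ℕ) (hκ : ∀ S : Finset (Fin n), |deviation μ B κ S| < 1) :
    (∀ k ∈ Finset.Icc 1 n, 0 < epsilonCoeff μ B κ k ∧ 0 < deltaCoeff μ B κ k) ∧
    prob μ (fun T => ∀ i, count B i T = κ i) ≥
      (∏ i, (κ i : ℝ) ^ κ i * Real.exp (-(κ i : ℝ)) / ((κ i).factorial : ℝ)) *
        (Finset.range (n + 1)).inf' Finset.nonempty_range_add_one (fun ℓ =>
          (∏ k ∈ Finset.Icc 1 ℓ, epsilonCoeff μ B κ k) *
            ∏ k ∈ Finset.Icc 1 (n - ℓ), deltaCoeff μ B κ k) := by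
  have hε0 := epsilonCoeff_pos hκ
  have hδ0 := deltaCoeff_pos hκ
  refine ⟨fun k _ => ⟨hε0 k, hδ0 k⟩, ?_⟩
  have hw := hμ.isStableWeight
  set A := (Finset.range (n + 1)).inf' Finset.nonempty_range_add_one (fun ℓ =>
    (∏ k ∈ Finset.Icc 1 ℓ, epsilonCoeff μ B κ k) *
      ∏ k ∈ Finset.Icc 1 (n - ℓ), deltaCoeff μ B κ k) with hA
  have hApos : 0 < A := by
    rw [hA, Finset.lt_inf'_iff]
    exact fun ℓ _ => mul_pos (Finset.prod_pos fun k _ => hε0 k) (Finset.prod_pos fun k _ => hδ0 k)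
  have hcap : ∀ x : Fin n → ℝ, (∀ i, 0 < x i) →
      A * ∏ i, x i ^ κ i ≤ ∑ T, (μ T).toReal * ∏ i, x i ^ (T ∩ B i).card := by
    intro x hx
    -- The capacity bound requires coefficients at most 1, hence the caps.
    obtain ⟨l, hl, h1⟩ := exists_capacity_bound hB κ
      (δ := fun k => min 1 (deltaCoeff μ B κ k)) (ε := fun k => min 1 (epsilonCoeff μ B κ k))
      (fun k => le_min zero_le_one (hδ0 k).le) (fun k => min_le_left _ _)
      (fun k => le_min zero_le_one (hε0 k).le) (fun k => min_le_left _ _) hw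
      (fun S _ => by
        have h2 := deltaCoeff_le (μ := μ) (B := B) (κ := κ) S
        rw [deviation_eq hB] at h2
        have h3 := min_le_right 1 (deltaCoeff μ B κ S.card)
        linarith)
      (fun S _ => by
        have h2 := epsilonCoeff_le (μ := μ) (B := B) (κ := κ) S
        rw [deviation_eq hB] at h2
        have h3 := min_le_right 1 (epsilonCoeff μ B κ S.card)
        linarith) hx
    obtain ⟨s, hs, h2⟩ := exists_prod_mul_prod_le_truncated (fun k _ => hδ0 k) (fun k _ => hε0 k)
      (fun k hk hk' => one_lt_deltaCoeff_succ hk hk')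
      (fun k hk hk' => one_lt_epsilonCoeff_succ hk hk')
      (deltaCoeff_add_epsilonCoeff_le (μ := μ) (B := B) (κ := κ) le_rfl) hl
    rw [sum_toReal_eq_one, one_mul] at h1
    refine le_trans (mul_le_mul_of_nonneg_right ?_
      (Finset.prod_nonneg fun i _ => pow_nonneg (hx i).le _)) h1
    exact (Finset.inf'_le _ (Finset.mem_range.2 (by omega : s < n + 1))).trans h2
  have h := prod_poissonMode_mul_le_coefficient (fun T i => (T ∩ B i).card) κ Finset.univ
    hw.nonneg (stableOn_blocks hB hw) hApos hcap
  rw [ge_iff_le, prob, Finset.sum_filter]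
  refine h.trans_eq (Finset.sum_congr rfl fun T _ => ?_)
  split_ifs with h1 h2 h2
  · rfl
  · exact absurd (fun i => h1 i (Finset.mem_univ i)) h2
  · exact absurd (fun i _ => h2 i) h1
  · rfl
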